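/- \textbf{Definitions.} For integers $\lambda,v,u\ge 0$ let $\lambda K_{v,u}$ be the multigraph whose vertex set is the disjoint union of a set $V$ with $|V|=v$ and a set $U$ with $|U|=u$, in which every vertex of $V$ is joined to every vertex of $U$ by exactly $\lambda$ parallel edges, and which has no other edges. For $m\ge 2$, a cycle of length $m$ (an $m$-cycle) consists of $m$ distinct vertices $x_0,\dots,x_{m-1}$ and $m$ distinct edges $e_0,\dots,e_{m-1}$ with $e_i$ joining $x_i$ and $x_{i+1}$ (indices modulo $m$); thus a $2$-cycle is a pair of parallel edges. A $1$-factor of a graph is a set of edges such that every vertex is incident with exactly one of them. A graph is even (odd) if all its vertices have even (odd) degree. For a finite sequence $M=m_1,\dots,m_t$ of integers, an $(M)^*$-cycle decomposition of a graph $G$ is: if $G$ is even, a partition of $E(G)$ into $t$ sets, the $i$-th of which induces an $m_i$-cycle; if $G$ is odd, a partition of $E(G)$ into a $1$-factor and $t$ sets, the $i$-th of which induces an $m_i$-cycle. (If $G$ is neither even nor odd, it has no $(M)^*$-cycle decomposition.) For a sequence $M$ and integers $a_1,\dots,a_r$, we write $(M,a_1,\dots,a_r)$ for the sequence $M$ followed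 by $a_1,\dots,a_r$. \textbf{Lemma.} Let $v\le u$, let $M$ be a finite sequence of integers, and let $h,m,m'$ be integers such that $\lambda K_{v,u}$ has an $(M,h,m,m')^*$-cycle decomposition. If \begin{itemize} \item $m+m'\le h$, \item $m+m'+h\le 2v+2$ in case $v<u$, and \item $m+m'+h\le 2v$ in case $v=u$, \end{itemize} then $\lambda K_{v,u}$ has an $(M,h,m+m')^*$-cycle decomposition. -/

import Mathlib

namespace Graph

variable {α β : Type*}

/-- The degree of a vertex of a (finite) multigraph: the number of edge-ends at it,
so that a loop counts twice. -/
noncomputable def mdegree (G : Graph α β) (x : α) : ℕ :=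
  {e | G.IsNonloopAt e x}.ncard + 2 * {e | G.IsLoopAt e x}.ncard

/-- A graph is even if all its vertices have even degree. -/
def IsEvenGraph (G : Graph α β) : Prop := ∀ x ∈ G.vertexSet, Even (G.mdegree x)

/-- A graph is odd if all its vertices have odd degree. -/
def IsOddGraph (G : Graph α β) : Prop := ∀ x ∈ G.vertexSet, Odd (G.mdegree x)

/-- A `1`-factor: a set of edges such that each vertex is incident with precisely one of them. -/
def IsOneFactor (G : Graph α β) (F : Set β) : Prop :=
  F ⊆ G.edgeSet ∧ ∀ x ∈ G.vertexSet, ∃! e, e ∈ F ∧ G.Inc e x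

/-- The edge set `C` induces a cycle of length `m ≥ 2` in `G`: there are `m` distinct vertices
`x i` and `m` distinct edges `e i`, indexed by the integers mod `m`, such that `e i` joins `x i`
to `x (i + 1)` and `C` consists of the edges `e i`. A cycle of length `2` is a pair of
parallel edges. -/
def IsCycleOfLength (G : Graph α β) (m : ℕ) (C : Set β) : Prop :=
  2 ≤ m ∧ ∃ (x : ZMod m → α) (e : ZMod m → β),
    Function.Injective x ∧ Function.Injective e ∧
    (∀ i, G.IsLink (e i) (x i) (x (i + 1))) ∧ Set.range e = C

/-- The edge set `S` can be partitioned into `M.length` sets, the `i`-th of which induces a cycle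
whose length is the `i`-th term of `M`. -/
def HasCyclePartition (G : Graph α β) (S : Set β) (M : List ℕ) : Prop :=
  ∃ C : Fin M.length → Set β,
    (∀ i, G.IsCycleOfLength (M.get i) (C i)) ∧
    Pairwise (fun i j => Disjoint (C i) (C j)) ∧
    ⋃ i, C i = S

/-- There is an `(M)`-cycle decomposition of `G`. -/
def HasCycleDecomposition (G : Graph α β) (M : List ℕ) : Prop :=
  G.HasCyclePartition G.edgeSet M

/-- There is an `(M)^*`-cycle decomposition of `G`: for an even graph this is an `(M)`-cycle
decomposition, and for an odd graph it is a partition of the edges into a `1`-factor and cycles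
whose lengths are given by `M`. -/
def HasStarCycleDecomposition (G : Graph α β) (M : List ℕ) : Prop :=
  (G.IsEvenGraph ∧ G.HasCycleDecomposition M) ∨
  (G.IsOddGraph ∧ ∃ F : Set β, G.IsOneFactor F ∧ G.HasCyclePartition (G.edgeSet \ F) M)

/-- The multigraph `λ K_{v,u}`: the parts are `Fin v` and `Fin u`, and the edges joining `a` in the
first part to `b` in the second part are `(a, b, k)`, for `k` in `Fin l`, where `l = λ`. -/
def completeBipartiteMultigraph (l v u : ℕ) :
    Graph (Fin v ⊕ Fin u) (Fin v × Fin u × Fin l) where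
  vertexSet := Set.univ
  edgeSet := Set.univ
  IsLink e x y :=
    (x = Sum.inl e.1 ∧ y = Sum.inr e.2.1) ∨ (x = Sum.inr e.2.1 ∧ y = Sum.inl e.1)
  isLink_symm := by
    intro e _
    exact ⟨fun x y h => h.elim (fun h => Or.inr ⟨h.2, h.1⟩) (fun h => Or.inl ⟨h.2, h.1⟩)⟩
  eq_or_eq_of_isLink_of_isLink := by
    rintro e x y z w (⟨rfl, rfl⟩ | ⟨rfl, rfl⟩) (⟨rfl, rfl⟩ | ⟨rfl, rfl⟩) <;> simp
  edge_mem_iff_exists_isLink := by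
    intro e
    exact ⟨fun _ => ⟨_, _, Or.inl ⟨rfl, rfl⟩⟩, fun _ => Set.mem_univ e⟩
  left_mem_of_isLink := fun _ _ _ _ => Set.mem_univ _

end Graph

/-! Two vertices in the same part of `λK_{v,u}` are joined equally often to every vertex; call them
twins. Take a packing by cycles, possibly with a 1-factor, and call the edges it does not use its
leave. If for twins α, β the leave contains αx but not βx, the packing uses βx more often than αx.
The edges of the packing at α and β fall into pairs that can be moved between α and β without
changing any cycle length. Following an alternating chain of such pairs, one replaces αx by βx in
the leave and changes just one further leave edge at α or β (`TwinHost.Leaves.switch`).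

Put t = m + m' and remove the three cycles. A switch makes the m-cycle and the m'-cycle either a
single cycle, which is the goal, or two cycles that share a vertex. Together with the h-cycle they
can then be switched to one closed walk with t + h edges whose excess e (edges minus vertices)
satisfies 1 ≤ e ≤ t - 1 (`TwinHost.Leaves.hasConnectedLeave`). It remains to turn this walk into a
t-cycle and an h-cycle (`TwinHost.HasConnectedLeave.hasTwoCycleLeave`).

If e = 1, the walk consists of two cycles sharing one vertex, and switching redistributes their
lengths. If e > 1 and some switch lowers e, induct. Otherwise the leave is rigid: a loop that could
be moved to an unused twin hangs at a single vertex and can be moved to any other vertex of the walk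
(`TwinHost.Leaves.exists_move`). Loops are thus transferred one by one from the walk to two paths
("ears") from α to β, until the walk is a cycle. A last switch closes everything into two cycles of
the prescribed lengths; its only bad outcome would permit lowering e.

The bound on m + m' + h supplies the unused twins: a closed walk with s edges has at most s/2
vertices on each side, and every coincidence of vertices frees one more. If v < u, the smaller side
may fall short by one vertex, so a side `b` is singled out and a coincidence on it is maintained.

Since parallel edges are interchangeable, all this is done with multisets of vertex pairs; edge
labels are restored at the end. -/

variable {X : Type*}

/-! ### Edge multisets of walks and closed walks -/

/-- The multiset of edges traversed by a walk, given by its list of vertices. -/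
def pathEdges : List X → Multiset (Sym2 X)
  | [] => 0
  | [_] => 0
  | a :: b :: l => {s(a, b)} + pathEdges (b :: l)

/-- The multiset of edges of the closed walk through the vertices of a list. -/
def cycleEdges : List X → Multiset (Sym2 X)
  | [] => 0
  | a :: l => pathEdges (a :: (l ++ [a]))

@[simp] lemma pathEdges_nil : pathEdges ([] : List X) = 0 := rfl

@[simp] lemma pathEdges_singleton (a : X) : pathEdges [a] = 0 := rfl

@[simp] lemma pathEdges_cons_cons (a b : X) (l : List X) :
    pathEdges (a :: b :: l) = {s(a, b)} + pathEdges (b :: l) := rfl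

lemma pathEdges_append (l₁ l₂ : List X) (x : X) :
    pathEdges (l₁ ++ x :: l₂) = pathEdges (l₁ ++ [x]) + pathEdges (x :: l₂) := by
  induction l₁ with
  | nil => simp
  | cons a l ih =>
    cases l with
    | nil => simp
    | cons b l => simp only [List.cons_append, pathEdges_cons_cons] at ih ⊢; rw [ih]; abel

lemma pathEdges_cons_append (a : X) (l₁ l₂ : List X) (x : X) :
    pathEdges (a :: (l₁ ++ x :: l₂)) = pathEdges (a :: (l₁ ++ [x])) + pathEdges (x :: l₂) :=
  pathEdges_append (a :: l₁) l₂ x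

lemma pathEdges_concat_concat (l : List X) (a b : X) :
    pathEdges (l ++ [a, b]) = pathEdges (l ++ [a]) + {s(a, b)} := by
  rw [pathEdges_append l [b] a]; simp

lemma pathEdges_reverse (l : List X) : pathEdges l.reverse = pathEdges l := by
  induction l with
  | nil => rfl
  | cons a l ih =>
    cases l with
    | nil => rfl
    | cons b l =>
      simp only [List.reverse_cons, List.append_assoc, List.cons_append, List.nil_append,
        pathEdges_cons_cons] at ih ⊢
      rw [pathEdges_concat_concat, ih, Sym2.eq_swap, add_comm]

lemma pathEdges_cons_of_ne_nil (a : X) {l : List X} (h : l ≠ []) :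
    pathEdges (a :: l) = {s(a, l.head h)} + pathEdges l := by
  cases l with
  | nil => exact absurd rfl h
  | cons b l => rfl

lemma pathEdges_concat_of_ne_nil (a : X) {l : List X} (h : l ≠ []) :
    pathEdges (l ++ [a]) = pathEdges l + {s(l.getLast h, a)} := by
  obtain ⟨l', b, rfl⟩ : ∃ l' b, l = l' ++ [b] :=
    ⟨l.dropLast, l.getLast h, (List.dropLast_append_getLast h).symm⟩
  simp [pathEdges_concat_concat]

lemma pathEdges_reverse_cons_concat (a b : X) (l : List X) :
    pathEdges (a :: (l.reverse ++ [b])) = pathEdges (b :: (l ++ [a])) := by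
  rw [← pathEdges_reverse (b :: (l ++ [a]))]; simp

lemma mem_of_mem_pathEdges {l : List X} {e : Sym2 X} {x : X} (he : e ∈ pathEdges l) (hx : x ∈ e) :
    x ∈ l := by
  induction l with
  | nil => simp at he
  | cons a l ih =>
    cases l with
    | nil => simp at he
    | cons b l =>
      simp only [pathEdges_cons_cons, Multiset.mem_add, Multiset.mem_singleton] at he
      rcases he with rfl | he
      · rcases Sym2.mem_iff.1 hx with rfl | rfl <;> simp
      · exact List.mem_cons_of_mem _ (ih he)

lemma notMem_pathEdges_left {l : List X} {x y : X} (hx : x ∉ l) : s(x, y) ∉ pathEdges l :=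
  fun h => hx (mem_of_mem_pathEdges h (Sym2.mem_mk_left x y))

lemma exists_eq_append_of_mem_pathEdges {l : List X} {x y : X} (h : s(x, y) ∈ pathEdges l) :
    ∃ l₁ l₂, l = l₁ ++ x :: y :: l₂ ∨ l = l₁ ++ y :: x :: l₂ := by
  induction l with
  | nil => simp at h
  | cons a l ih =>
    cases l with
    | nil => simp at h
    | cons b l =>
      simp only [pathEdges_cons_cons, Multiset.mem_add, Multiset.mem_singleton] at h
      rcases h with h | h
      · rcases Sym2.eq_iff.1 h with ⟨rfl, rfl⟩ | ⟨rfl, rfl⟩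
        · exact ⟨[], l, Or.inl rfl⟩
        · exact ⟨[], l, Or.inr rfl⟩
      · obtain ⟨l₁, l₂, h | h⟩ := ih h
        · exact ⟨a :: l₁, l₂, Or.inl (by simp [h])⟩
        · exact ⟨a :: l₁, l₂, Or.inr (by simp [h])⟩

lemma pathEdges_rotate (a b : X) (l₁ l₂ : List X) :
    pathEdges (a :: (l₁ ++ b :: (l₂ ++ [a]))) = pathEdges (b :: (l₂ ++ a :: (l₁ ++ [b]))) := by
  rw [pathEdges_cons_append a l₁ (l₂ ++ [a]) b, pathEdges_cons_append b l₂ (l₁ ++ [b]) a, add_comm]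

lemma cycleEdges_cons (a : X) (l : List X) : cycleEdges (a :: l) = pathEdges (a :: (l ++ [a])) :=
  rfl

lemma cycleEdges_rotate (a : X) (l₁ l₂ : List X) :
    cycleEdges (l₁ ++ a :: l₂) = cycleEdges (a :: (l₂ ++ l₁)) := by
  cases l₁ with
  | nil => simp
  | cons b l₁ =>
    have := pathEdges_rotate b a l₁ l₂
    simpa [cycleEdges_cons] using this

lemma cycleEdges_cons_cons_of_ne_nil (a : X) {l : List X} (h : l ≠ []) :
    cycleEdges (a :: l) = {s(a, l.head h)} + pathEdges l + {s(a, l.getLast h)} := by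
  rw [cycleEdges_cons, pathEdges_cons_of_ne_nil a (l := l ++ [a]) (by simp),
    pathEdges_concat_of_ne_nil a h, List.head_append_left h, Sym2.eq_swap (a := l.getLast h),
    add_assoc]

/-! ### Hosts with twins, and chains of switch units -/

/-- A finite bipartite multigraph, as a multiset of edges, in which any two vertices of the same
part are joined to each vertex by the same number of edges. In packings of it, each `1`-factor
part is a `1`-factor if `hasFactor` holds, and empty otherwise. -/
structure TwinHost (X : Type*) [DecidableEq X] where
  side : X → Bool
  edges : Multiset (Sym2 X)
  side_ne : ∀ a b, s(a, b) ∈ edges → side a ≠ side b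
  count_eq : ∀ a b x, side a = side b → edges.count s(a, x) = edges.count s(b, x)
  hasFactor : Prop

/-- A unit of a packing: two edges, each joining a vertex to the first or the second of two
given twins, that have to be switched together. -/
abbrev SwitchUnit (X : Type*) := (X × Bool) × (X × Bool)

namespace SwitchUnit

def flipEnd (p : X × Bool) : X × Bool := (p.1, !p.2)

def flip (u : SwitchUnit X) : SwitchUnit X := (flipEnd u.1, flipEnd u.2)

def endEdge (α β : X) (p : X × Bool) : Sym2 X := s(if p.2 then β else α, p.1)

def ends (us : Multiset (SwitchUnit X)) : Multiset (X × Bool) :=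
  us.map Prod.fst + us.map Prod.snd

def edges (α β : X) (u : SwitchUnit X) : Multiset (Sym2 X) :=
  {endEdge α β u.1} + {endEdge α β u.2}

lemma ends_add (us vs : Multiset (SwitchUnit X)) : ends (us + vs) = ends us + ends vs := by
  simp only [ends, Multiset.map_add]; abel

lemma ends_singleton (u : SwitchUnit X) : ends {u} = {u.1} + {u.2} := by
  simp [ends]

lemma sum_map_edges (α β : X) (us : Multiset (SwitchUnit X)) :
    (us.map (edges α β)).sum = (ends us).map (endEdge α β) := by
  induction us using Multiset.induction with
  | empty => simp [ends]
  | cons u us ih =>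
    rw [← Multiset.singleton_add, ends_add, Multiset.map_add, Multiset.map_add, Multiset.sum_add,
      ih, ends_singleton]
    simp [edges]

variable [DecidableEq X]

/-- Flipping some of the units changes, up to cancellation, a given abundant end and one other. -/
theorem exists_flip (us : Multiset (SwitchUnit X)) (x : X) (b : Bool)
    (hx : (ends us).count (x, !b) < (ends us).count (x, b)) :
    ∃ J K y c, us = J + K ∧
      ends (J.map flip) + ends K + {(x, b)} + {(y, c)} = ends us + {(x, !b)} + {(y, !c)} ∧
      (ends us).count (y, !c) < (ends us).count (y, c) ∧
      (y = x → c = b ∧ (ends us).count (x, !b) + 2 ≤ (ends us).count (x, b)) := by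
  induction hn : us.card generalizing us x b with
  | zero => simp [Multiset.card_eq_zero.1 hn, ends] at hx
  | succ n ih =>
    -- Follow a chain: a unit containing the abundant end has a second end `(y, c)`, and flipping
    -- the unit produces `(y, !c)`. The chain may stop if `(y, c)` was itself abundant at the
    -- outset; otherwise it continues in the remaining units `R`.
    obtain ⟨y, c, u, R, hR, hu⟩ : ∃ y c, ∃ (u : SwitchUnit X) (R : Multiset (SwitchUnit X)),
        us = {u} + R ∧ (u = ((x, b), (y, c)) ∨ u = ((y, c), (x, b))) := by
      have hmem : (x, b) ∈ ends us := Multiset.count_pos.1 (by omega)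
      simp only [ends, Multiset.mem_add, Multiset.mem_map] at hmem
      obtain ⟨u, hu, h⟩ | ⟨u, hu, h⟩ := hmem
      · exact ⟨u.2.1, u.2.2, u, us.erase u, by simp [hu], Or.inl (by rw [← h])⟩
      · exact ⟨u.1.1, u.1.2, u, us.erase u, by simp [hu], Or.inr (by rw [← h])⟩
    have hends : ends us = {(x, b)} + {(y, c)} + ends R := by
      rw [hR, ends_add, ends_singleton]
      rcases hu with rfl | rfl <;> simp [add_comm]
    have hflip : ends ((({u} : Multiset (SwitchUnit X))).map flip) = {(x, !b)} + {(y, !c)} := by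
      rw [Multiset.map_singleton, ends_singleton]
      rcases hu with rfl | rfl <;> simp [flip, flipEnd, add_comm]
    have hcard : R.card = n := by
      rw [hR] at hn; simp at hn; omega
    have hcnt : ∀ z d, (ends us).count (z, d) =
        (if (z, d) = (x, b) then 1 else 0) + (if (z, d) = (y, c) then 1 else 0) +
          (ends R).count (z, d) := by
      intro z d
      rw [hends, Multiset.count_add, Multiset.count_add, Multiset.count_singleton,
        Multiset.count_singleton]
    have hne : ∀ d : Bool, (!d) ≠ d := by decide
    by_cases hterm : (ends us).count (y, !c) < (ends us).count (y, c) ∧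
      (y = x → c = b ∧ (ends us).count (x, !b) + 2 ≤ (ends us).count (x, b))
    · refine ⟨{u}, R, y, c, hR, ?_, hterm.1, hterm.2⟩
      rw [hflip, hends]; abel
    -- A unit with ends `(x, b)` and `(x, !b)` is invariant under flipping. It is put aside
    -- unflipped, and the differences of counts at `x` stay the same.
    by_cases hyx : y = x ∧ c ≠ b
    · obtain ⟨rfl, hcb⟩ := hyx
      have hcb' : c = !b := by revert hcb; cases b <;> cases c <;> simp
      subst hcb'
      have h1 := hcnt y b
      have h2 := hcnt y (!b)
      simp [hne] at h1 h2
      obtain ⟨J, K, w, d, hJK, he, hw, hwx⟩ := ih R y b (by omega) hcard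
      refine ⟨J, {u} + K, w, d, by rw [hR, hJK]; abel, ?_, ?_, ?_⟩
      · have : ends us = ends {u} + ends R := by rw [hR, ends_add]
        rw [ends_add, this]
        calc _ = (ends (J.map flip) + ends K + {(y, b)} + {(w, d)}) + ends {u} := by abel
          _ = _ := by rw [he]; abel
      · by_cases hwy : w = y
        · subst hwy
          obtain ⟨rfl, -⟩ := hwx rfl
          omega
        · rw [hcnt, hcnt]; simpa [hwy] using hw
      · intro hwy
        exact ⟨(hwx hwy).1, by have := (hwx hwy).2; omega⟩
    -- In `us` the end `(y, c)` was not abundant enough to stop, so with this unit used up `(y, !c)`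
    -- is abundant in `R`. The chain goes on from there after flipping `u`.
    · have hR' : (ends R).count (y, c) < (ends R).count (y, !c) := by
        have h1 := hcnt y c
        have h2 := hcnt y (!c)
        by_cases hyx' : y = x
        · subst hyx'
          have hcb : c = b := by by_contra h; exact hyx ⟨rfl, h⟩
          subst hcb
          simp [hne] at h1 h2
          simp only [forall_const, true_and] at hterm
          omega
        · simp [hne, hyx'] at h1 h2
          simp only [hyx', false_imp_iff, and_true] at hterm
          omega
      obtain ⟨J, K, w, d, hJK, he, hw, hwy⟩ := ih R y (!c) (by simpa using hR') hcard
      rw [Bool.not_not] at he hwy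
      refine ⟨{u} + J, K, w, d, by rw [hR, hJK]; abel, ?_, ?_, ?_⟩
      · rw [Multiset.map_add, ends_add, hflip, hends]
        have he' : ends (J.map flip) + ends K + {(w, d)} + {(y, !c)} =
            ends R + {(y, c)} + {(w, !d)} := by rw [← he]; abel
        calc _ = {(x, !b)} + {(x, b)} + (ends (J.map flip) + ends K + {(w, d)} + {(y, !c)}) := by
              abel
          _ = _ := by rw [he']; abel
      · have h1 := hcnt w d
        have h2 := hcnt w (!d)
        by_cases hwy' : w = y
        · subst hwy'
          obtain ⟨rfl, h3⟩ := hwy rfl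
          rw [Bool.not_not] at h2 ⊢
          by_cases hwx : w = x
          · subst hwx
            have hcb : c = b := by by_contra h; exact hyx ⟨rfl, h⟩
            subst hcb
            simp [hne] at h1 h2
            omega
          · simp [hne, hwx] at h1 h2
            omega
        · by_cases hwx : w = x
          · subst hwx
            by_cases hdb : d = b
            · subst hdb; simp [hne, hwy'] at h1 h2; omega
            · have hdb' : d = !b := by revert hdb; cases b <;> cases d <;> simp
              subst hdb'
              rw [Bool.not_not] at h2 hw ⊢
              simp [hne, hwy'] at h1 h2; omega
          · simp [hwx, hwy'] at h1 h2; omega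
      · intro hwx
        subst hwx
        have h1 := hcnt w b
        have h2 := hcnt w (!b)
        by_cases hwy' : w = y
        · subst hwy'
          obtain ⟨rfl, h3⟩ := hwy rfl
          have hcb : c = b := by by_contra h; exact hyx ⟨rfl, h⟩
          subst hcb
          simp [hne] at h1 h2
          omega
        · by_cases hdb : d = b
          · subst hdb
            refine ⟨rfl, ?_⟩
            simp [hne, hwy'] at h1 h2; omega
          · have hdb' : d = !b := by revert hdb; cases b <;> cases d <;> simp
            subst hdb'
            rw [Bool.not_not] at hw
            simp [hne, hwy'] at h1 h2; omega

end SwitchUnit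

/-! ### Splitting cycles into units at two twins -/

namespace SwitchUnit

/-- Every packing obtained from the units `us` by flipping some of them satisfies `G`. -/
def Flexible (α β : X) (G : Multiset (Sym2 X) → Prop) :
    List (SwitchUnit X) → Multiset (Sym2 X) → Prop
  | [], B => G B
  | u :: us, B => Flexible α β G us (B + edges α β u) ∧ Flexible α β G us (B + edges α β u.flip)

lemma Flexible.flip_part [DecidableEq X] {α β : X} {G : Multiset (Sym2 X) → Prop}
    {us : List (SwitchUnit X)}
    {B : Multiset (Sym2 X)} (h : Flexible α β G us B) {J K : Multiset (SwitchUnit X)}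
    (hJK : (us : Multiset (SwitchUnit X)) = J + K) :
    G (B + ((J.map flip).map (edges α β)).sum + (K.map (edges α β)).sum) := by
  induction us generalizing B J K with
  | nil =>
    have h0 : J + K = 0 := hJK.symm
    obtain ⟨rfl, rfl⟩ : J = 0 ∧ K = 0 := by simpa using h0
    simpa [Flexible] using h
  | cons u us ih =>
    rw [← Multiset.cons_coe] at hJK
    have hu : u ∈ J + K := by rw [← hJK]; simp
    rcases Multiset.mem_add.1 hu with hu | hu
    · obtain ⟨J', rfl⟩ := Multiset.exists_cons_of_mem hu
      rw [Multiset.cons_add, Multiset.cons_inj_right] at hJK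
      have := ih h.2 hJK
      simp only [Multiset.map_cons, Multiset.sum_cons]
      convert this using 2
      abel
    · obtain ⟨K', rfl⟩ := Multiset.exists_cons_of_mem hu
      rw [Multiset.add_cons, Multiset.cons_inj_right] at hJK
      have := ih h.1 hJK
      simp only [Multiset.map_cons, Multiset.sum_cons]
      convert this using 1
      abel

lemma Flexible.add {α β : X} {G G₁ G₂ : Multiset (Sym2 X) → Prop}
    {us vs : List (SwitchUnit X)} {B C : Multiset (Sym2 X)}
    (h₁ : Flexible α β G₁ us B) (h₂ : Flexible α β G₂ vs C)
    (h : ∀ D E, G₁ D → G₂ E → G (D + E)) : Flexible α β G (us ++ vs) (B + C) := by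
  induction us generalizing B with
  | nil =>
    simp only [List.nil_append]
    induction vs generalizing C with
    | nil => exact h _ _ h₁ h₂
    | cons v vs ih => exact ⟨by rw [add_assoc]; exact ih h₂.1, by rw [add_assoc]; exact ih h₂.2⟩
  | cons u us ih =>
    refine ⟨?_, ?_⟩
    · rw [add_right_comm]; exact ih h₁.1
    · rw [add_right_comm]; exact ih h₁.2

/-- The edges at `α` and `β` of the edge multiset `E` are arranged in units, and `G` holds for
each result of flipping some of these units. -/
def Decomposes (α β : X) (G : Multiset (Sym2 X) → Prop) (E : Multiset (Sym2 X)) : Prop :=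
  ∃ (us : List (SwitchUnit X)) (B : Multiset (Sym2 X)),
    E = B + ((us : Multiset (SwitchUnit X)).map (edges α β)).sum ∧ Flexible α β G us B ∧
    (∀ p ∈ ends (us : Multiset (SwitchUnit X)), p.1 ≠ α ∧ p.1 ≠ β) ∧
    ∀ e ∈ B, α ∉ e ∧ β ∉ e

lemma Decomposes.add {α β : X} {G G₁ G₂ : Multiset (Sym2 X) → Prop} {D E : Multiset (Sym2 X)}
    (h₁ : Decomposes α β G₁ D) (h₂ : Decomposes α β G₂ E)
    (h : ∀ D E, G₁ D → G₂ E → G (D + E)) : Decomposes α β G (D + E) := by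
  obtain ⟨us, B, rfl, hus, he, hB⟩ := h₁
  obtain ⟨vs, C, rfl, hvs, he', hC⟩ := h₂
  refine ⟨us ++ vs, B + C, ?_, hus.add hvs h, ?_, ?_⟩
  · rw [← Multiset.coe_add, Multiset.map_add, Multiset.sum_add]; abel
  · intro p hp
    rw [← Multiset.coe_add, ends_add, Multiset.mem_add] at hp
    exact hp.elim (he p) (he' p)
  · intro e hp
    exact (Multiset.mem_add.1 hp).elim (hB e) (hC e)

lemma Decomposes.of_avoid {α β : X} {G : Multiset (Sym2 X) → Prop} {E : Multiset (Sym2 X)}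
    (h : G E) (hE : ∀ e ∈ E, α ∉ e ∧ β ∉ e) : Decomposes α β G E :=
  ⟨[], E, by simp, h, by simp [ends], hE⟩

/-- A single unit. -/
lemma Decomposes.of_unit {α β : X} {G : Multiset (Sym2 X) → Prop} {B : Multiset (Sym2 X)}
    (u : SwitchUnit X) (h₁ : G (B + edges α β u)) (h₂ : G (B + edges α β u.flip))
    (hu : u.1.1 ≠ α ∧ u.1.1 ≠ β ∧ u.2.1 ≠ α ∧ u.2.1 ≠ β)
    (hB : ∀ e ∈ B, α ∉ e ∧ β ∉ e) : Decomposes α β G (B + edges α β u) := by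
  refine ⟨[u], B, by simp, ⟨h₁, h₂⟩, ?_, hB⟩
  intro p hp
  simp only [ends, Multiset.coe_singleton, Multiset.map_singleton, Multiset.mem_add,
    Multiset.mem_singleton] at hp
  rcases hp with rfl | rfl
  · exact ⟨hu.1, hu.2.1⟩
  · exact ⟨hu.2.2.1, hu.2.2.2⟩

lemma not_mem_of_pathEdges {l : List X} {α β : X} (hα : α ∉ l) (hβ : β ∉ l) :
    ∀ e ∈ pathEdges l, α ∉ e ∧ β ∉ e := fun _ he =>
  ⟨fun h => hα (mem_of_mem_pathEdges he h), fun h => hβ (mem_of_mem_pathEdges he h)⟩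

/-- Edge multisets of cycles of length `n`. -/
def IsCycleEdges (n : ℕ) (E : Multiset (Sym2 X)) : Prop :=
  ∃ c : List X, c.Nodup ∧ c.length = n ∧ cycleEdges c = E

lemma exists_rotation {c : List X} (hc : c.Nodup) {α : X} (h : α ∈ c) :
    ∃ S, (α :: S).Nodup ∧ S.length + 1 = c.length ∧ cycleEdges (α :: S) = cycleEdges c ∧
      ∀ x, x ∈ α :: S ↔ x ∈ c := by
  obtain ⟨s, t, rfl⟩ := List.append_of_mem h
  refine ⟨t ++ s, ?_, by simp; omega, (cycleEdges_rotate _ _ _).symm, ?_⟩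
  · have : (s ++ α :: t).Perm (α :: (t ++ s)) := by
      have := List.perm_append_comm (l₁ := s) (l₂ := α :: t)
      simpa using this
    exact this.nodup_iff.1 hc
  · intro x; simp; tauto

/-- The two edges at the only twin on the cycle form one unit; flipping it replaces that vertex by
the other twin. -/
lemma cycle_decomposes_single {S : List X} {α β : X} (hS : S ≠ []) (hc : (α :: S).Nodup)
    (hβ : β ∉ α :: S) : Decomposes α β (IsCycleEdges (S.length + 1)) (cycleEdges (α :: S)) ∧
      Decomposes β α (IsCycleEdges (S.length + 1)) (cycleEdges (α :: S)) := by
  simp only [List.mem_cons, not_or] at hβ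
  have hα : α ∉ S := (List.nodup_cons.1 hc).1
  have hne : ∀ x ∈ S, x ≠ α ∧ x ≠ β := fun x hx =>
    ⟨fun h => hα (h ▸ hx), fun h => hβ.2 (h ▸ hx)⟩
  have h1 : IsCycleEdges (S.length + 1) (cycleEdges (α :: S)) := ⟨_, hc, by simp, rfl⟩
  have h2 : IsCycleEdges (S.length + 1) (cycleEdges (β :: S)) :=
    ⟨β :: S, List.nodup_cons.2 ⟨hβ.2, (List.nodup_cons.1 hc).2⟩, by simp, rfl⟩
  have hh := hne _ (List.head_mem hS)
  have hl := hne _ (List.getLast_mem hS)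
  have hα' : ∀ x, cycleEdges (x :: S) = pathEdges S + ({s(x, S.head hS)} + {s(x, S.getLast hS)}) :=
    fun x => by rw [cycleEdges_cons_cons_of_ne_nil x hS]; abel
  rw [hα'] at h1 h2 ⊢
  constructor
  · exact Decomposes.of_unit (α := α) (β := β) ((S.head hS, false), (S.getLast hS, false))
      h1 h2 ⟨hh.1, hh.2, hl.1, hl.2⟩ (not_mem_of_pathEdges hα hβ.2)
  · exact Decomposes.of_unit (α := β) (β := α) ((S.head hS, true), (S.getLast hS, true))
      h1 h2 ⟨hh.2, hh.1, hl.2, hl.1⟩ (not_mem_of_pathEdges hβ.2 hα)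

lemma cycleEdges_cons_append_cons (α β : X) {S T : List X} (hS : S ≠ []) (hT : T ≠ []) :
    cycleEdges (α :: (S ++ β :: T)) = pathEdges S + pathEdges T +
      ({s(α, S.head hS)} + {s(β, S.getLast hS)}) + ({s(β, T.head hT)} + {s(α, T.getLast hT)}) := by
  rw [cycleEdges_cons, List.append_assoc, List.cons_append, pathEdges_cons_append,
    pathEdges_cons_of_ne_nil α (l := S ++ [β]) (by simp), pathEdges_concat_of_ne_nil β hS,
    List.head_append_left hS, pathEdges_cons_of_ne_nil β (l := T ++ [α]) (by simp),
    pathEdges_concat_of_ne_nil α hT, List.head_append_left hT,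
    Sym2.eq_swap (a := S.getLast hS), Sym2.eq_swap (a := T.getLast hT)]
  abel

/-- The twins cut the cycle into two arcs with interiors `S` and `T`. The end edges of each arc form
a unit, and flipping it amounts to traversing the arc backwards, so the two units can be flipped
independently. -/
lemma cycle_decomposes_double {S T : List X} {α β : X} (hS : S ≠ []) (hT : T ≠ [])
    (hc : (α :: (S ++ β :: T)).Nodup) :
    Decomposes α β (IsCycleEdges (S.length + T.length + 2)) (cycleEdges (α :: (S ++ β :: T))) := by
  have hrev : ∀ S' T' : List X, S'.Perm S → T'.Perm T →
      IsCycleEdges (S.length + T.length + 2) (cycleEdges (α :: (S' ++ β :: T'))) := by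
    intro S' T' h1 h2
    refine ⟨_, ?_, ?_, rfl⟩
    · exact ((h1.append (h2.cons β)).cons α).nodup_iff.2 hc
    · simp [h1.length_eq, h2.length_eq]; omega
  simp only [List.nodup_cons, List.mem_append, List.mem_cons, not_or] at hc
  obtain ⟨⟨hαS, hαβ, hαT⟩, hnd⟩ := hc
  rw [List.nodup_append, List.nodup_cons] at hnd
  have hβS : β ∉ S := fun h => hnd.2.2 β h β (by simp) rfl
  have hβT : β ∉ T := hnd.2.1.1
  have hneS : ∀ x ∈ S, x ≠ α ∧ x ≠ β := fun x hx =>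
    ⟨fun h => hαS (h ▸ hx), fun h => hβS (h ▸ hx)⟩
  have hneT : ∀ x ∈ T, x ≠ α ∧ x ≠ β := fun x hx =>
    ⟨fun h => hαT (h ▸ hx), fun h => hβT (h ▸ hx)⟩
  have hS' : S.reverse ≠ [] := by simpa
  have hT' : T.reverse ≠ [] := by simpa
  have e1 := hrev S T (List.Perm.refl _) (List.Perm.refl _)
  have e2 := hrev S T.reverse (List.Perm.refl _) (List.reverse_perm _)
  have e3 := hrev S.reverse T (List.reverse_perm _) (List.Perm.refl _)
  have e4 := hrev S.reverse T.reverse (List.reverse_perm _) (List.reverse_perm _)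
  rw [cycleEdges_cons_append_cons α β hS hT] at e1 ⊢
  rw [cycleEdges_cons_append_cons α β hS hT'] at e2
  rw [cycleEdges_cons_append_cons α β hS' hT] at e3
  rw [cycleEdges_cons_append_cons α β hS' hT'] at e4
  simp only [pathEdges_reverse, List.head_reverse, List.getLast_reverse] at e1 e2 e3 e4
  refine ⟨[((S.head hS, false), (S.getLast hS, true)), ((T.head hT, true), (T.getLast hT, false))],
    pathEdges S + pathEdges T, ?_, ⟨⟨?_, ?_⟩, ?_, ?_⟩, ?_, ?_⟩
  · simp [edges, endEdge, add_assoc]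
  · exact e1
  · change IsCycleEdges (S.length + T.length + 2) (_ + _ + _)
    convert e2 using 1
    simp only [edges, endEdge, flip, flipEnd, Bool.not_true, Bool.not_false, if_true,
      Bool.false_eq_true, if_false]
    abel
  · change IsCycleEdges (S.length + T.length + 2) (_ + _ + _)
    convert e3 using 1
    simp only [edges, endEdge, flip, flipEnd, Bool.not_true, Bool.not_false, if_true,
      Bool.false_eq_true, if_false]
    abel
  · change IsCycleEdges (S.length + T.length + 2) (_ + _ + _)
    convert e4 using 1
    simp only [edges, endEdge, flip, flipEnd, Bool.not_true, Bool.not_false, if_true,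
      Bool.false_eq_true, if_false]
    abel
  · intro p hp
    simp only [ends, Multiset.map_coe, List.map_cons, List.map_nil, Multiset.coe_add,
      List.cons_append, List.nil_append, Multiset.mem_coe, List.mem_cons, List.not_mem_nil,
      or_false] at hp
    rcases hp with rfl | rfl | rfl | rfl
    · exact hneS _ (List.head_mem hS)
    · exact hneT _ (List.head_mem hT)
    · exact hneS _ (List.getLast_mem hS)
    · exact hneT _ (List.getLast_mem hT)
  · intro e he
    exact (Multiset.mem_add.1 he).elim (not_mem_of_pathEdges hαS hβS e)
      (not_mem_of_pathEdges hαT hβT e)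

/-- The cycle passes through both twins, one or none. Non-adjacency makes both arcs between the
twins have interior vertices. -/
lemma cycle_decomposes [DecidableEq X] {c : List X} {α β : X} (hc : c.Nodup) (hl : 2 ≤ c.length)
    (hαβ : α ≠ β) (hadj : s(α, β) ∉ cycleEdges c) :
    Decomposes α β (IsCycleEdges c.length) (cycleEdges c) := by
  by_cases hα : α ∈ c
  · obtain ⟨S, hS, hlen, hce, hmem⟩ := exists_rotation hc hα
    rw [← hce, ← hlen]
    rw [← hce] at hadj
    by_cases hβ : β ∈ α :: S
    · have hβS : β ∈ S := by
        rcases List.mem_cons.1 hβ with h | h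
        · exact absurd h.symm hαβ
        · exact h
      obtain ⟨S₁, S₂, rfl⟩ := List.append_of_mem hβS
      have h1 : S₁ ≠ [] := by
        rintro rfl; apply hadj; simp [cycleEdges_cons]
      have h2 : S₂ ≠ [] := by
        rintro rfl; apply hadj
        rw [cycleEdges_cons, List.append_assoc, List.cons_append, List.nil_append,
          ← List.cons_append, pathEdges_concat_concat]
        simp [Sym2.eq_swap (a := β)]
      have := cycle_decomposes_double h1 h2 hS
      convert this using 2
      simp; omega
    · exact (cycle_decomposes_single (by rintro rfl; simp at hlen; omega) hS hβ).1
  · by_cases hβ : β ∈ c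
    · obtain ⟨S, hS, hlen, hce, hmem⟩ := exists_rotation hc hβ
      rw [← hce, ← hlen]
      exact (cycle_decomposes_single (by rintro rfl; simp at hlen; omega) hS
        (fun h => hα ((hmem α).1 h))).2
    · refine Decomposes.of_avoid ⟨c, hc, rfl, rfl⟩ ?_
      cases c with
      | nil => simp at hl
      | cons a l => exact not_mem_of_pathEdges (by simp at hα ⊢; tauto) (by simp at hβ ⊢; tauto)

end SwitchUnit

/-! ### Packings, leaves and the switching theorem -/

namespace TwinHost

open SwitchUnit

variable [DecidableEq X] (H : TwinHost X)

/-- The factor part of a packing. -/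
def IsFactorPart (F : Multiset (Sym2 X)) : Prop :=
  (¬ H.hasFactor ∧ F = 0) ∨ (H.hasFactor ∧ ∀ x, (F.filter (x ∈ ·)).card = 1)

/-- The edge multisets of packings with cycles whose lengths are given by `N`. -/
def Packs (N : Multiset ℕ) (E : Multiset (Sym2 X)) : Prop :=
  ∃ (C : Multiset (List X)) (F : Multiset (Sym2 X)),
    (∀ c ∈ C, c.Nodup ∧ 2 ≤ c.length) ∧ C.map List.length = N ∧ H.IsFactorPart F ∧
      E = (C.map cycleEdges).sum + F

/-- `L` is the leave of a packing with cycles whose lengths are given by `N`. -/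
def Leaves (N : Multiset ℕ) (L : Multiset (Sym2 X)) : Prop :=
  ∃ E, H.Packs N E ∧ E + L = H.edges

/-- The factor edges at α and β form a unit: exchanging their other ends gives a 1-factor again.
They are two different edges because `s(α, β)` is not in `F`. -/
lemma factor_decomposes {F : Multiset (Sym2 X)} (hF : H.IsFactorPart F) {α β : X} (hαβ : α ≠ β)
    (hadj : s(α, β) ∉ F) (hαα : s(α, α) ∉ F) (hββ : s(β, β) ∉ F) :
    Decomposes α β H.IsFactorPart F := by
  rcases hF with ⟨h, rfl⟩ | ⟨h, hF⟩
  · exact Decomposes.of_avoid (Or.inl ⟨h, rfl⟩) (by simp)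
  · have key : ∀ v, ∃ x, F.filter (v ∈ ·) = {s(v, x)} := by
      intro v
      obtain ⟨e, he⟩ := Multiset.card_eq_one.1 (hF v)
      have hv : v ∈ e := (Multiset.mem_filter.1 (he ▸ Multiset.mem_singleton_self e :
        e ∈ F.filter (v ∈ ·))).2
      obtain ⟨x, rfl⟩ := hv
      exact ⟨x, he⟩
    obtain ⟨x, hx⟩ := key α
    obtain ⟨y, hy⟩ := key β
    have hxF : s(α, x) ∈ F := Multiset.mem_of_mem_filter
      (hx ▸ Multiset.mem_singleton_self _ : s(α, x) ∈ F.filter (α ∈ ·))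
    have hyF : s(β, y) ∈ F := Multiset.mem_of_mem_filter
      (hy ▸ Multiset.mem_singleton_self _ : s(β, y) ∈ F.filter (β ∈ ·))
    have hxα : x ≠ α := by rintro rfl; exact hαα hxF
    have hxβ : x ≠ β := by rintro rfl; exact hadj hxF
    have hyα : y ≠ α := by rintro rfl; rw [Sym2.eq_swap] at hyF; exact hadj hyF
    have hyβ : y ≠ β := by rintro rfl; exact hββ hyF
    obtain ⟨B, hB⟩ : ∃ B, F = B + ({s(α, x)} + {s(β, y)}) := by
      have hle : {s(α, x)} + {s(β, y)} ≤ F := by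
        have hne : s(α, x) ≠ s(β, y) := by simp [hαβ, Ne.symm hyα]
        rw [Multiset.singleton_add, Multiset.cons_le_of_notMem (by simpa using hne)]
        exact ⟨hxF, by simpa using hyF⟩
      exact ⟨F - ({s(α, x)} + {s(β, y)}), (Multiset.sub_add_cancel hle).symm⟩
    have hB0 : ∀ e ∈ B, α ∉ e ∧ β ∉ e := by
      intro e he
      constructor
      · intro hαe
        have h0 : (F.filter (α ∈ ·)).card = 1 := hF α
        have h1 : e ∈ B.filter (α ∈ ·) := Multiset.mem_filter.2 ⟨he, hαe⟩
        have h2 := Multiset.card_pos_iff_exists_mem.2 ⟨e, h1⟩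
        have h3 : (Multiset.filter (α ∈ ·) {s(α, x)}).card = 1 := by
          simp [Multiset.filter_singleton]
        rw [hB, Multiset.filter_add, Multiset.filter_add, Multiset.card_add,
          Multiset.card_add] at h0
        omega
      · intro hβe
        have h0 : (F.filter (β ∈ ·)).card = 1 := hF β
        have h1 : e ∈ B.filter (β ∈ ·) := Multiset.mem_filter.2 ⟨he, hβe⟩
        have h2 := Multiset.card_pos_iff_exists_mem.2 ⟨e, h1⟩
        have h3 : (Multiset.filter (β ∈ ·) {s(β, y)}).card = 1 := by
          simp [Multiset.filter_singleton]
        rw [hB, Multiset.filter_add, Multiset.filter_add, Multiset.card_add,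
          Multiset.card_add] at h0
        omega
    rw [hB]
    refine Decomposes.of_unit (α := α) (β := β) ((x, false), (y, true)) ?_ ?_
      ⟨hxα, hxβ, hyα, hyβ⟩ hB0
    · rw [show B + SwitchUnit.edges α β ((x, false), (y, true)) = F from hB.symm]
      exact Or.inr ⟨h, hF⟩
    · refine Or.inr ⟨h, fun v => ?_⟩
      have hxy : x ≠ y := by
        rintro rfl
        have h1 := hF x
        rw [hB] at h1
        simp [Multiset.filter_singleton] at h1
      rw [← hF v, hB]
      simp only [Multiset.filter_add, Multiset.card_add, Multiset.filter_singleton,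
        SwitchUnit.edges, endEdge, SwitchUnit.flip, flipEnd, Sym2.mem_iff]
      by_cases h1 : v = α
      · subst h1; simp [hαβ, Ne.symm hxα, Ne.symm hyα]
      by_cases h2 : v = β
      · subst h2; simp [Ne.symm hαβ, Ne.symm hxβ, Ne.symm hyβ]
      simp [h1, h2]
      split_ifs <;> simp

lemma packs_decomposes {N : Multiset ℕ} {E : Multiset (Sym2 X)} (hE : H.Packs N E)
    (hle : E ≤ H.edges) {α β : X} (hαβ : α ≠ β) (hside : H.side α = H.side β) :
    Decomposes α β (H.Packs N) E := by
  have hno : ∀ {D : Multiset (Sym2 X)} (x y : X), D ≤ H.edges → H.side x = H.side y →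
      s(x, y) ∉ D := fun x y hD hxy h => H.side_ne x y (Multiset.mem_of_le hD h) hxy
  obtain ⟨C, F, hC, rfl, hF, rfl⟩ := hE
  induction C using Multiset.induction with
  | empty =>
    simp only [Multiset.map_zero, Multiset.sum_zero, zero_add] at hle ⊢
    have := H.factor_decomposes hF hαβ (hno _ _ hle hside) (hno _ _ hle rfl) (hno _ _ hle rfl)
    obtain ⟨us, B, h1, h2, h3, h4⟩ := this
    have := Decomposes.add (D := 0) (E := F) (G₁ := fun D => D = 0) (G := H.Packs 0)
      (α := α) (β := β) (Decomposes.of_avoid rfl (by simp)) ⟨us, B, h1, h2, h3, h4⟩ (by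
        rintro D E rfl hE
        exact ⟨0, E, by simp, by simp, hE, by simp⟩)
    simpa using this
  | cons c C ih =>
    simp only [Multiset.map_cons, Multiset.sum_cons] at hle ⊢
    have hc := hC c (by simp)
    have h1 : cycleEdges c ≤ H.edges := by
      refine le_trans ?_ hle
      rw [add_assoc]
      exact Multiset.le_add_right _ _
    have h2 : (C.map cycleEdges).sum + F ≤ H.edges := by
      refine le_trans ?_ hle
      rw [add_assoc]
      exact Multiset.le_add_left _ _
    have := Decomposes.add (cycle_decomposes hc.1 hc.2 hαβ (hno _ _ h1 hside))
      (ih (fun d hd => hC d (by simp [hd])) h2) (G := H.Packs (c.length ::ₘ C.map List.length)) (by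
        rintro D E ⟨d, hd, hdl, rfl⟩ ⟨C', F', hC', hN, hF', rfl⟩
        refine ⟨d ::ₘ C', F', ?_, by simp [hdl, hN], hF', by simp [add_assoc]⟩
        intro c' hc'
        rcases Multiset.mem_cons.1 hc' with rfl | h
        · exact ⟨hd, hdl ▸ hc.2⟩
        · exact hC' _ h)
    rwa [← add_assoc] at this

/-- Cycle switching. -/
theorem Leaves.switch {H : TwinHost X} {N : Multiset ℕ} {L : Multiset (Sym2 X)} {α β x : X}
    (hL : H.Leaves N ({s(α, x)} + L)) (hαβ : α ≠ β) (hside : H.side α = H.side β)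
    (hx : s(β, x) ∉ ({s(α, x)} + L : Multiset (Sym2 X))) :
    ∃ y L', (L = {s(α, y)} + L' ∧ H.Leaves N (L' + {s(β, x)} + {s(β, y)})) ∨
      (L = {s(β, y)} + L' ∧ H.Leaves N (L' + {s(β, x)} + {s(α, y)})) := by
  obtain ⟨E, hE, hEL⟩ := hL
  have hle : E ≤ H.edges := hEL ▸ Multiset.le_add_right _ _
  have hLle : {s(α, x)} + L ≤ H.edges := hEL ▸ Multiset.le_add_left _ _
  have hadj : ∀ a b, s(a, b) ∈ E → H.side a ≠ H.side b := fun a b h =>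
    H.side_ne a b (Multiset.mem_of_le hle h)
  obtain ⟨us, B, hEB, hflex, hends, hB⟩ := H.packs_decomposes hE hle hαβ hside
  rw [sum_map_edges] at hEB
  have hxα : x ≠ α := by
    rintro rfl
    exact H.side_ne x x (Multiset.mem_of_le hLle (by simp)) rfl
  have hxβ : x ≠ β := by
    rintro rfl
    exact H.side_ne α x (Multiset.mem_of_le hLle (by simp)) hside
  -- The part `B` avoids both twins and no unit end is a twin, so multiplicities in the packing of
  -- edges at α or β are multiplicities of unit ends.
  have hcount : ∀ z, z ≠ α → z ≠ β → ∀ b,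
      E.count (endEdge α β (z, b)) = (ends (us : Multiset (SwitchUnit X))).count (z, b) := by
    intro z hzα hzβ b
    rw [hEB, Multiset.count_add, Multiset.count_eq_zero_of_notMem, zero_add, Multiset.count_map,
      Multiset.count, Multiset.countP_eq_card_filter]
    · congr 1
      apply Multiset.filter_congr
      rintro ⟨w, c⟩ hp
      have := hends _ hp
      simp only [endEdge, Prod.mk.injEq]
      constructor
      · intro h
        rcases Sym2.eq_iff.1 h with ⟨h1, h2⟩ | ⟨h1, h2⟩
        · refine ⟨h2, ?_⟩
          revert h1; cases b <;> cases c <;> simp [hαβ, hαβ.symm]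
        · exfalso
          cases c
          · exact hzα h2
          · exact hzβ h2
      · rintro ⟨rfl, rfl⟩; rfl
    · intro h
      have := hB _ h
      cases b <;> simp [endEdge] at this
  have hcL : ∀ e, E.count e + ({s(α, x)} + L).count e = H.edges.count e := by
    intro e; rw [← Multiset.count_add, hEL]
  -- Twins have equal multiplicities in the host. The leave has `s(α, x)` but not `s(β, x)`, so the
  -- packing has `s(β, x)` in surplus.
  have hlt : (ends (us : Multiset (SwitchUnit X))).count (x, !true) <
      (ends (us : Multiset (SwitchUnit X))).count (x, true) := by
    rw [← hcount x hxα hxβ, ← hcount x hxα hxβ]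
    have h1 := hcL s(α, x)
    have h2 := hcL s(β, x)
    have h3 := H.count_eq α β x hside
    have h4 : 0 < ({s(α, x)} + L).count s(α, x) := Multiset.count_pos.2 (by simp)
    have h5 := Multiset.count_eq_zero_of_notMem hx
    change E.count s(α, x) < E.count s(β, x)
    omega
  obtain ⟨J, K, y, c, hJK, he, hy, hyx⟩ := exists_flip _ x true hlt
  have hy' : (y, c) ∈ ends (us : Multiset (SwitchUnit X)) := Multiset.count_pos.1 (by omega)
  obtain ⟨hyα, hyβ⟩ := hends _ hy'
  have hP := hflex.flip_part hJK
  rw [sum_map_edges, sum_map_edges] at hP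
  set E' := B + (ends (J.map flip)).map (endEdge α β) + (ends K).map (endEdge α β) with hE'
  have hEE : E' + {s(β, x)} + {endEdge α β (y, c)} = E + {s(α, x)} + {endEdge α β (y, !c)} := by
    have := congrArg (Multiset.map (endEdge α β)) he
    simp only [Multiset.map_add, Multiset.map_singleton] at this
    rw [hEB, hE']
    calc _ = B + (Multiset.map (endEdge α β) (ends (Multiset.map flip J)) +
          Multiset.map (endEdge α β) (ends K) + {endEdge α β (x, true)} +
            {endEdge α β (y, c)}) := by simp only [endEdge, if_true]; abel
      _ = _ := by rw [this]; simp [endEdge, add_assoc]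
  -- The edge at `y` to one twin is abundant in the packing, so the edge to the other twin lies in
  -- the leave. If `y = x`, the surplus of at least two guarantees a copy besides the one already
  -- used.
  have hmem : endEdge α β (y, !c) ∈ L := by
    have h1 := hcL (endEdge α β (y, c))
    have h2 := hcL (endEdge α β (y, !c))
    rw [hcount y hyα hyβ] at h1 h2
    have h3 : H.edges.count (endEdge α β (y, c)) = H.edges.count (endEdge α β (y, !c)) := by
      cases c <;> simp [endEdge, H.count_eq α β y hside]
    apply Multiset.count_pos.1
    rw [Multiset.count_add, Multiset.count_singleton] at h2
    by_cases hyx' : y = x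
    · obtain ⟨rfl, h4⟩ := hyx hyx'
      subst hyx'
      split_ifs at h2 <;> omega
    · have : endEdge α β (y, !c) ≠ s(α, x) := by
        intro h
        simp only [endEdge] at h
        rcases Sym2.eq_iff.1 h with ⟨-, h⟩ | ⟨-, h⟩
        · exact hyx' h
        · exact hyα h
      rw [if_neg this] at h2
      omega
  obtain ⟨L', rfl⟩ := Multiset.exists_cons_of_mem hmem
  have hfin : H.Leaves N (L' + {s(β, x)} + {endEdge α β (y, c)}) := by
    refine ⟨E', hP, ?_⟩
    calc _ = (E' + {s(β, x)} + {endEdge α β (y, c)}) + L' := by abel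
      _ = _ := by rw [hEE, ← hEL, ← Multiset.singleton_add]; abel
  refine ⟨y, L', ?_⟩
  cases c
  · exact Or.inr ⟨by simp [endEdge], by simpa [endEdge] using hfin⟩
  · exact Or.inl ⟨by simp [endEdge], by simpa [endEdge] using hfin⟩

end TwinHost

/-! ### Closed walks: joining, opening and cutting -/

section ClosedWalks

variable [DecidableEq X]

/-- `L` is the edge multiset of a closed walk with `n` edges and vertex set `V`. -/
def IsClosedWalk (L : Multiset (Sym2 X)) (n : ℕ) (V : Finset X) : Prop :=
  ∃ c S, L = pathEdges (c :: (S ++ [c])) ∧ n = S.length + 1 ∧ V = (c :: S).toFinset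

lemma isClosedWalk_pathEdges (c : X) (S : List X) :
    IsClosedWalk (pathEdges (c :: (S ++ [c]))) (S.length + 1) (c :: S).toFinset :=
  ⟨c, S, rfl, rfl, rfl⟩

namespace IsClosedWalk

variable {L L' : Multiset (Sym2 X)} {n n' : ℕ} {V V' : Finset X}

lemma exists_base (h : IsClosedWalk L n V) {x : X} (hx : x ∈ V) :
    ∃ S, L = pathEdges (x :: (S ++ [x])) ∧ n = S.length + 1 ∧ V = (x :: S).toFinset := by
  obtain ⟨c, S, rfl, rfl, rfl⟩ := h
  rw [List.mem_toFinset, List.mem_cons] at hx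
  rcases hx with rfl | hx
  · exact ⟨S, rfl, rfl, rfl⟩
  · obtain ⟨s, t, rfl⟩ := List.append_of_mem hx
    refine ⟨t ++ c :: s, ?_, by simp; omega, ?_⟩
    · have := pathEdges_rotate c x s t
      simpa using this
    · ext y; simp; tauto

lemma mem_of_mem (h : IsClosedWalk L n V) {e : Sym2 X} (he : e ∈ L) {x : X} (hx : x ∈ e) :
    x ∈ V := by
  obtain ⟨c, S, rfl, rfl, rfl⟩ := h
  have := mem_of_mem_pathEdges he hx
  simp at this ⊢; tauto

lemma add (h : IsClosedWalk L n V) (h' : IsClosedWalk L' n' V') {x : X} (hx : x ∈ V)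
    (hx' : x ∈ V') : IsClosedWalk (L + L') (n + n') (V ∪ V') := by
  obtain ⟨S, rfl, rfl, rfl⟩ := h.exists_base hx
  obtain ⟨T, rfl, rfl, rfl⟩ := h'.exists_base hx'
  refine ⟨x, S ++ x :: T, ?_, by simp; omega, ?_⟩
  · have := pathEdges_cons_append x S (T ++ [x]) x
    simpa using this.symm
  · ext y; simp

/-- Deleting an edge opens the closed walk to a walk between the ends of that edge. The cases are
that the edge is the first one of the list, the last one, or neither. -/
lemma exists_open_aux {K : Multiset (Sym2 X)} {c y w : X} {S l₁ l₂ : List X} (hyw : y ≠ w)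
    (hK : {s(y, w)} + K = pathEdges (c :: (S ++ [c])))
    (hl : c :: (S ++ [c]) = l₁ ++ y :: w :: l₂) :
    ∃ T, K = pathEdges (w :: (T ++ [y])) ∧ S.length + 1 = T.length + 2 ∧
      (c :: S).toFinset = (w :: (T ++ [y])).toFinset := by
  have hK' : K = pathEdges (l₁ ++ [y]) + pathEdges (w :: l₂) := by
    rw [hl, pathEdges_append, pathEdges_cons_cons] at hK
    apply add_left_cancel (a := ({s(y, w)} : Multiset (Sym2 X)))
    rw [hK]; abel
  have hlen := congrArg List.length hl
  cases l₁ with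
  | nil =>
    simp only [List.nil_append, List.cons.injEq] at hl
    obtain ⟨rfl, hl⟩ := hl
    cases S with
    | nil => simp at hl; exact absurd hl.1 hyw
    | cons a S =>
      simp only [List.cons_append, List.cons.injEq] at hl
      obtain ⟨rfl, rfl⟩ := hl
      exact ⟨S, by simpa using hK', by simp, by ext z; simp; tauto⟩
  | cons a l₁ =>
    simp only [List.cons_append, List.cons.injEq] at hl
    obtain ⟨rfl, hl⟩ := hl
    rcases List.eq_nil_or_concat l₂ with rfl | ⟨l₃, d, rfl⟩
    · have hl' : S ++ [c] = (l₁ ++ [y]) ++ [w] := by simpa using hl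
      obtain ⟨rfl, h⟩ := List.append_inj' hl' rfl
      simp only [List.cons.injEq, and_true] at h
      subst h
      refine ⟨l₁, by simpa using hK', by simp, by ext z; simp⟩
    · have hl' : S ++ [c] = (l₁ ++ y :: w :: l₃) ++ [d] := by simpa using hl
      obtain ⟨rfl, h⟩ := List.append_inj' hl' rfl
      simp only [List.cons.injEq, and_true] at h
      subst h
      refine ⟨l₃ ++ c :: l₁, ?_, by simp; omega, by ext z; simp; tauto⟩
      rw [List.append_assoc, List.cons_append, pathEdges_cons_append w l₃ (l₁ ++ [y]) c, hK']
      simp [add_comm]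

lemma exists_open {K : Multiset (Sym2 X)} {y w : X} (hyw : y ≠ w)
    (h : IsClosedWalk ({s(y, w)} + K) n V) :
    ∃ T, K = pathEdges (w :: (T ++ [y])) ∧ n = T.length + 2 ∧
      V = (w :: (T ++ [y])).toFinset := by
  obtain ⟨c, S, hK, rfl, rfl⟩ := h
  obtain ⟨l₁, l₂, hl | hl⟩ := exists_eq_append_of_mem_pathEdges
    (hK ▸ Multiset.mem_add.2 (Or.inl (Multiset.mem_singleton_self _)) :
      s(y, w) ∈ pathEdges (c :: (S ++ [c])))
  · exact exists_open_aux hyw hK hl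
  · rw [Sym2.eq_swap] at hK
    obtain ⟨T, h1, h2, h3⟩ := exists_open_aux hyw.symm hK hl
    refine ⟨T.reverse, ?_, by simpa using h2, ?_⟩
    · rw [pathEdges_reverse_cons_concat]; exact h1
    · rw [h3]; ext z; simp; tauto

/-- Replacing an edge of a closed walk by a path. -/
lemma replace {K : Multiset (Sym2 X)} {y w : X} (hyw : y ≠ w)
    (h : IsClosedWalk ({s(y, w)} + K) n V) (S : List X) :
    IsClosedWalk (K + pathEdges (y :: (S ++ [w]))) (n + S.length) (V ∪ S.toFinset) := by
  obtain ⟨T, rfl, rfl, rfl⟩ := h.exists_open hyw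
  refine ⟨y, S ++ w :: T, ?_, by simp; omega, by ext z; simp; tauto⟩
  rw [List.append_assoc, List.cons_append, pathEdges_cons_append y S (T ++ [y]) w, add_comm]

end IsClosedWalk

/-- The shortest suffix with a repetition among the entries satisfying `p` begins with the first
occurrence of the repeated entry, and beyond it nothing is repeated. If `p` always holds, `x :: l₂`
is a loop without repeated vertices. -/
lemma List.exists_repeat (p : X → Prop) [DecidablePred p] (W : List X)
    (hW : ¬ (W.filter (p ·)).Nodup) :
    ∃ l₁ x l₂ l₃, W = l₁ ++ x :: (l₂ ++ x :: l₃) ∧ p x ∧ x ∉ l₂ ∧ (l₂.filter (p ·)).Nodup := by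
  induction W with
  | nil => simp at hW
  | cons a W ih =>
    by_cases h : (W.filter (p ·)).Nodup
    · by_cases ha : p a
      · have haW : a ∈ W := by
          by_contra h'
          apply hW
          rw [List.filter_cons_of_pos (by simpa using ha), List.nodup_cons]
          exact ⟨fun h'' => h' (List.mem_of_mem_filter h''), h⟩
        obtain ⟨s, t, rfl, hs⟩ := List.eq_append_cons_of_mem haW
        refine ⟨[], a, s, t, rfl, ha, hs, ?_⟩
        rw [List.filter_append] at h
        exact (List.nodup_append.1 h).1
      · rw [List.filter_cons_of_neg (by simpa using ha)] at hW
        exact absurd h hW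
    · obtain ⟨l₁, x, l₂, l₃, rfl, h1⟩ := ih h
      exact ⟨a :: l₁, x, l₂, l₃, rfl, h1⟩

lemma List.nodup_of_filter_nodup {l : List X} {p : X → Prop} [DecidablePred p]
    (h₁ : (l.filter (p ·)).Nodup) (h₂ : (l.filter (¬ p ·)).Nodup) : l.Nodup := by
  rw [List.nodup_iff_count_le_one] at h₁ h₂ ⊢
  intro a
  by_cases ha : p a
  · have := h₁ a; rwa [List.count_filter (by simpa using ha)] at this
  · have := h₂ a; rwa [List.count_filter (by simpa using ha)] at this

/-- Cutting a closed walk at a repeated vertex. -/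
lemma isClosedWalk_cut {c x : X} {S l₁ l₂ l₃ : List X}
    (h : c :: S = l₁ ++ x :: (l₂ ++ x :: l₃)) :
    ∃ K V, pathEdges (c :: (S ++ [c])) = pathEdges (x :: (l₂ ++ [x])) + K ∧
      IsClosedWalk K (l₁.length + l₃.length + 1) V ∧ V = (x :: (l₁ ++ l₃)).toFinset ∧
      c ∈ V ∧ x ∈ V ∧ (c :: S).toFinset = V ∪ l₂.toFinset ∧
      S.length = l₁.length + l₂.length + l₃.length + 1 := by
  cases l₁ with
  | nil =>
    simp only [List.nil_append, List.cons.injEq] at h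
    obtain ⟨rfl, rfl⟩ := h
    refine ⟨pathEdges (c :: (l₃ ++ [c])), _, ?_, ?_, rfl, by simp, by simp, ?_, ?_⟩
    · have := pathEdges_cons_append c l₂ (l₃ ++ [c]) c
      simpa using this
    · simpa using isClosedWalk_pathEdges c l₃
    · ext y; simp; tauto
    · simp; omega
  | cons a l₁ =>
    simp only [List.cons_append, List.cons.injEq] at h
    obtain ⟨rfl, rfl⟩ := h
    refine ⟨pathEdges (c :: ((l₁ ++ x :: l₃) ++ [c])), _, ?_, ?_, rfl, by simp, by simp, ?_, ?_⟩
    · have h1 := pathEdges_cons_append c l₁ (l₂ ++ x :: (l₃ ++ [c])) x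
      have h2 := pathEdges_cons_append x l₂ (l₃ ++ [c]) x
      have h3 := pathEdges_cons_append c l₁ (l₃ ++ [c]) x
      simp only [List.append_assoc, List.cons_append]
      rw [h1, h2, h3]; abel
    · refine ⟨c, l₁ ++ x :: l₃, rfl, by simp; omega, ?_⟩
      ext y; simp; tauto
    · ext y; simp; tauto
    · simp; omega

end ClosedWalks

/-! ### Vertex counts on the two sides, and moving cycles within a leave -/

namespace TwinHost

variable [DecidableEq X] {H : TwinHost X} {N : Multiset ℕ} {L K : Multiset (Sym2 X)} {n : ℕ}
  {V : Finset X}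

lemma Leaves.side_ne (h : H.Leaves N L) {x y : X} (hxy : s(x, y) ∈ L) : H.side x ≠ H.side y := by
  obtain ⟨E, -, hE⟩ := h
  exact H.side_ne x y (hE ▸ Multiset.mem_add.2 (Or.inr hxy))

/-- The edges of the multiset join vertices of different sides. -/
def Alternates (H : TwinHost X) (L : Multiset (Sym2 X)) : Prop :=
  ∀ x y, s(x, y) ∈ L → H.side x ≠ H.side y

lemma Leaves.alternates (h : H.Leaves N L) : H.Alternates L := fun _ _ => h.side_ne

lemma Alternates.left {L K : Multiset (Sym2 X)} (h : H.Alternates (L + K)) : H.Alternates L :=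
  fun x y hxy => h x y (Multiset.mem_add.2 (Or.inl hxy))

lemma Alternates.right {L K : Multiset (Sym2 X)} (h : H.Alternates (L + K)) : H.Alternates K :=
  fun x y hxy => h x y (Multiset.mem_add.2 (Or.inr hxy))

/-- The indicator function of a side. -/
def sideInd (H : TwinHost X) (b : Bool) (v : X) : ℕ := if H.side v = b then 1 else 0

lemma Alternates.two_mul_countP (b : Bool) {a z : X} {l : List X}
    (h : H.Alternates (pathEdges (a :: (l ++ [z])))) :
    2 * (a :: (l ++ [z])).countP (H.side · = b) = l.length + 1 + H.sideInd b a + H.sideInd b z := by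
  have hpair : ∀ x y, H.side x ≠ H.side y → H.sideInd b x + H.sideInd b y = 1 := by
    intro x y hxy
    unfold sideInd
    revert hxy
    cases H.side x <;> cases H.side y <;> cases b <;> simp
  have hcons : ∀ (x : X) (l : List X), (x :: l).countP (H.side · = b) =
      l.countP (H.side · = b) + H.sideInd b x := by
    intro x l; simp [List.countP_cons, sideInd]
  induction l generalizing a with
  | nil =>
    have := hpair a z (h a z (by simp))
    simp only [List.nil_append, hcons, List.countP_nil, List.length_nil]
    omega
  | cons c l ih =>
    simp only [List.cons_append, pathEdges_cons_cons] at h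
    have := ih h.right
    have := hpair a c (h a c (by simp))
    simp only [List.cons_append, hcons a, List.length_cons]
    omega

lemma Alternates.side_eq {a z : X} {l : List X} (h : H.Alternates (pathEdges (a :: (l ++ [z]))))
    (hl : Even (l.length + 1)) : H.side a = H.side z := by
  have := h.two_mul_countP (H.side a)
  obtain ⟨k, hk⟩ := hl
  by_contra hne
  simp [sideInd, Ne.symm hne] at this
  omega

lemma Alternates.two_mul_countP_closed (b : Bool) {c : X} {S : List X}
    (h : H.Alternates (pathEdges (c :: (S ++ [c])))) :
    2 * (c :: S).countP (H.side · = b) = S.length + 1 := by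
  have := h.two_mul_countP b
  rw [← List.cons_append, List.countP_append] at this
  have h1 : [c].countP (H.side · = b) = H.sideInd b c := by simp [sideInd, List.countP_cons]
  omega

lemma Alternates.even (h : H.Alternates L) (hL : IsClosedWalk L n V) : Even n := by
  obtain ⟨c, S, rfl, rfl, rfl⟩ := hL
  exact ⟨_, by rw [← two_mul]; exact (h.two_mul_countP_closed true).symm⟩

/-- The vertices of `V` on side `b`. -/
def onSide (H : TwinHost X) (b : Bool) (V : Finset X) : Finset X := V.filter (H.side · = b)

lemma mem_onSide {b : Bool} {x : X} : x ∈ H.onSide b V ↔ x ∈ V ∧ H.side x = b :=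
  Finset.mem_filter

lemma onSide_union (b : Bool) (V W : Finset X) :
    H.onSide b (V ∪ W) = H.onSide b V ∪ H.onSide b W := Finset.filter_union _ _ _

/-- The walk alternates between the sides, so it makes n/2 visits to each. All unused vertices
needed later are found by comparing this bound with the size of a side. -/
lemma Alternates.two_mul_card_onSide_le (h : H.Alternates L) (hL : IsClosedWalk L n V) (b : Bool) :
    2 * (H.onSide b V).card ≤ n := by
  obtain ⟨c, S, rfl, rfl, rfl⟩ := hL
  have h1 := h.two_mul_countP_closed b
  have h2 : (H.onSide b (c :: S).toFinset).card ≤ (c :: S).countP (H.side · = b) := by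
    rw [List.countP_eq_length_filter]
    refine le_trans (Finset.card_le_card ?_) (List.toFinset_card_le _)
    intro x hx
    rw [mem_onSide] at hx
    simpa using hx
  omega

lemma Alternates.two_le (h : H.Alternates L) (hL : IsClosedWalk L n V) : 2 ≤ n := by
  have h1 := h.even hL
  obtain ⟨c, S, rfl, rfl, rfl⟩ := hL
  obtain ⟨k, hk⟩ := h1
  omega

lemma Alternates.exists_mem_side (h : H.Alternates L) (hL : IsClosedWalk L n V) (b : Bool) :
    ∃ x ∈ V, H.side x = b := by
  obtain ⟨c, S, rfl, rfl, rfl⟩ := hL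
  have h1 := h.two_mul_countP_closed b
  obtain ⟨x, hx, hx'⟩ := List.countP_pos_iff.1 (show 0 < (c :: S).countP (H.side · = b) by omega)
  exact ⟨x, by simpa using hx, by simpa using hx'⟩

/-- Splitting a closed walk off at a vertex `c` by moving one visit of `c` to a new vertex `γ`:
either this works out, or everything is joined to a single closed walk. -/
lemma Leaves.split {c γ : X} {S : List X} (h : H.Leaves N (pathEdges (c :: (S ++ [c])) + K))
    (hS : S ≠ []) (hc : c ∉ S) (hK : IsClosedWalk K n V) (hcγ : c ≠ γ)
    (hside : H.side c = H.side γ) (hγS : γ ∉ S) (hγV : γ ∉ V) :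
    H.Leaves N (pathEdges (γ :: (S ++ [γ])) + K) ∨
      ∃ L, H.Leaves N L ∧ IsClosedWalk L (n + S.length + 1) (insert γ (V ∪ S.toFinset)) := by
  have e1 : ∀ v, pathEdges (v :: (S ++ [v])) =
      {s(v, S.head hS)} + ({s(v, S.getLast hS)} + pathEdges S) := by
    intro v
    rw [← cycleEdges_cons, cycleEdges_cons_cons_of_ne_nil v hS]; abel
  have hγ : s(γ, S.head hS) ∉ pathEdges (c :: (S ++ [c])) + K := by
    rw [Multiset.mem_add, not_or]
    constructor
    · apply notMem_pathEdges_left; simp [hγS, hcγ.symm]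
    · exact fun h' => hγV (hK.mem_of_mem h' (Sym2.mem_mk_left _ _))
  have hE : pathEdges (c :: (S ++ [c])) + K =
      {s(c, S.head hS)} + ({s(c, S.getLast hS)} + pathEdges S + K) := by rw [e1]; abel
  rw [hE] at h hγ
  -- Since γ is not on the leave, the second edge affected is an edge `s(c, y)`. Either it closes
  -- the cycle through `S`, which then moves to γ as a whole, or it belongs to `K`.
  obtain ⟨y, L', ⟨h1, h2⟩ | ⟨h1, -⟩⟩ := h.switch hcγ hside hγ
  · have hy : s(c, y) ∈ ({s(c, S.getLast hS)} + pathEdges S + K : Multiset (Sym2 X)) := by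
      rw [h1]; simp
    rw [Multiset.mem_add, Multiset.mem_add, Multiset.mem_singleton, or_assoc] at hy
    rcases hy with hy | hy | hy
    · left
      have hL' : L' = pathEdges S + K := by
        rw [hy, add_assoc] at h1
        exact (add_left_cancel h1).symm
      have hy' : y = S.getLast hS := Sym2.congr_right.1 hy
      rw [hL', hy'] at h2
      rw [e1]
      convert h2 using 1
      abel
    · exact absurd hy (notMem_pathEdges_left hc)
    · right
      obtain ⟨K', rfl⟩ := Multiset.exists_cons_of_mem hy
      rw [← Multiset.singleton_add] at h1 hK
      have hL' : L' = {s(c, S.getLast hS)} + pathEdges S + K' := by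
        apply add_left_cancel (a := ({s(c, y)} : Multiset (Sym2 X)))
        rw [← h1]; abel
      have hcy : c ≠ y := by
        rintro rfl
        exact h.side_ne (show s(c, c) ∈ _ by
          rw [← Multiset.singleton_add]; simp) rfl
      refine ⟨_, h2, ?_⟩
      -- The edge from `c` to `y` has become the path from `c` backwards through `S` to γ and on to
      -- `y`.
      have := hK.replace hcy (S.reverse ++ [γ])
      convert this using 1
      · rw [hL', List.append_assoc, List.singleton_append,
          pathEdges_cons_append c S.reverse [y] γ, pathEdges_cons_of_ne_nil c (by simp),
          pathEdges_concat_of_ne_nil γ (by simpa), List.head_append_left (by simpa),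
          pathEdges_reverse, List.head_reverse, List.getLast_reverse,
          Sym2.eq_swap (a := γ) (b := S.head hS)]
        simp only [pathEdges_cons_cons, pathEdges_singleton]
        abel
      · simp; omega
      · ext z; simp
  · exfalso
    have : s(γ, y) ∈ ({s(c, S.getLast hS)} + pathEdges S + K : Multiset (Sym2 X)) := by
      rw [h1]; simp
    rw [Multiset.mem_add, Multiset.mem_add, or_assoc] at this
    rcases this with h' | h' | h'
    · rw [Multiset.mem_singleton] at h'
      rcases Sym2.eq_iff.1 h' with ⟨h', -⟩ | ⟨h', -⟩
      · exact hcγ h'.symm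
      · exact hγS (h' ▸ List.getLast_mem hS)
    · exact notMem_pathEdges_left hγS h'
    · exact hγV (hK.mem_of_mem h' (Sym2.mem_mk_left _ _))

/-- Attaching a cycle at a vertex `y` of a closed walk disjoint from it:
either this works out, or everything is joined to a single closed walk. -/
lemma Leaves.attach {z y : X} {S : List X} (h : H.Leaves N (pathEdges (z :: (S ++ [z])) + K))
    (hS : S ≠ []) (hz : z ∉ S) (hK : IsClosedWalk K n V) (hy : y ∈ V)
    (hside : H.side z = H.side y) (hd : ∀ x ∈ z :: S, x ∉ V) :
    H.Leaves N (pathEdges (y :: (S ++ [y])) + K) ∨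
      ∃ L, H.Leaves N L ∧ IsClosedWalk L (n + S.length + 1) (insert z (V ∪ S.toFinset)) := by
  have hzV : z ∉ V := hd z (by simp)
  have hyS : y ∉ S := fun h' => hd y (by simp [h']) hy
  have hzy : z ≠ y := fun h' => hzV (h' ▸ hy)
  have e1 : ∀ v, pathEdges (v :: (S ++ [v])) =
      {s(v, S.head hS)} + ({s(v, S.getLast hS)} + pathEdges S) := by
    intro v
    rw [← cycleEdges_cons, cycleEdges_cons_cons_of_ne_nil v hS]; abel
  have hγ : s(y, S.head hS) ∉ pathEdges (z :: (S ++ [z])) + K := by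
    rw [Multiset.mem_add, not_or]
    constructor
    · apply notMem_pathEdges_left; simp [hyS, hzy.symm]
    · exact fun h' => hd (S.head hS) (by simp) (hK.mem_of_mem h' (Sym2.mem_mk_right _ _))
  have hE : pathEdges (z :: (S ++ [z])) + K =
      {s(z, S.head hS)} + ({s(z, S.getLast hS)} + pathEdges S + K) := by rw [e1]; abel
  rw [hE] at h hγ
  -- By disjointness, the second edge affected is either the other edge of the cycle at `z`, so that
  -- the cycle moves to `y`, or an edge `s(y, w)` of `K`, which is replaced by the path from `y`
  -- through `S` and `z` to `w`.
  obtain ⟨w, L', ⟨h1, h2⟩ | ⟨h1, h2⟩⟩ := h.switch hzy hside hγ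
  · left
    have hw : s(z, w) ∈ ({s(z, S.getLast hS)} + pathEdges S + K : Multiset (Sym2 X)) := by
      rw [h1]; simp
    rw [Multiset.mem_add, Multiset.mem_add, Multiset.mem_singleton, or_assoc] at hw
    rcases hw with hw | hw | hw
    · have hL' : L' = pathEdges S + K := by
        rw [hw, add_assoc] at h1
        exact (add_left_cancel h1).symm
      have hw' : w = S.getLast hS := Sym2.congr_right.1 hw
      rw [hL', hw'] at h2
      rw [e1]
      convert h2 using 1
      abel
    · exact absurd hw (notMem_pathEdges_left hz)
    · exact absurd (hK.mem_of_mem hw (Sym2.mem_mk_left _ _)) hzV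
  · right
    have hw : s(y, w) ∈ ({s(z, S.getLast hS)} + pathEdges S + K : Multiset (Sym2 X)) := by
      rw [h1]; simp
    rw [Multiset.mem_add, Multiset.mem_add, Multiset.mem_singleton, or_assoc] at hw
    rcases hw with hw | hw | hw
    · exfalso
      rcases Sym2.eq_iff.1 hw with ⟨hw, -⟩ | ⟨hw, -⟩
      · exact hzy hw.symm
      · exact hyS (hw ▸ List.getLast_mem hS)
    · exact absurd hw (notMem_pathEdges_left hyS)
    · obtain ⟨K', rfl⟩ := Multiset.exists_cons_of_mem hw
      rw [← Multiset.singleton_add] at h1 hK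
      have hL' : L' = {s(z, S.getLast hS)} + pathEdges S + K' := by
        apply add_left_cancel (a := ({s(y, w)} : Multiset (Sym2 X)))
        rw [← h1]; abel
      have hyw : y ≠ w := by
        rintro rfl
        exact h.side_ne (show s(y, y) ∈ _ by
          rw [← Multiset.singleton_add]; simp) rfl
      refine ⟨_, h2, ?_⟩
      have := hK.replace hyw (S ++ [z])
      convert this using 1
      · rw [hL', List.append_assoc, List.singleton_append,
          pathEdges_cons_append y S [w] z, pathEdges_cons_of_ne_nil y (by simp),
          pathEdges_concat_of_ne_nil z hS, List.head_append_left hS,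
          Sym2.eq_swap (a := z) (b := S.getLast hS)]
        simp only [pathEdges_cons_cons, pathEdges_singleton]
        abel
      · simp; omega
      · ext z; simp

/-- Closing up two paths with common ends `α` and `β` by switching `α` and `β`. -/
lemma Leaves.close {α β : X} {A B : List X}
    (h : H.Leaves N (pathEdges (α :: (A ++ [β])) + pathEdges (α :: (B ++ [β]))))
    (hA : A ≠ []) (hB : B ≠ []) (hαA : α ∉ A) (hβA : β ∉ A) (hαB : α ∉ B) (hβB : β ∉ B)
    (hαβ : α ≠ β) (hside : H.side α = H.side β)
    (h₁ : A.head hA ≠ A.getLast hA) (h₂ : A.head hA ≠ B.getLast hB) :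
    H.Leaves N (pathEdges (β :: (A ++ [β])) + pathEdges (β :: (B ++ [β]))) ∨
    H.Leaves N (pathEdges (β :: (A ++ [β])) + pathEdges (α :: (B ++ [α]))) ∨
    H.Leaves N (pathEdges (β :: (A ++ [α])) + pathEdges (α :: (B ++ [β]))) := by
  have e1 : ∀ u v (C : List X) (hC : C ≠ []), pathEdges (u :: (C ++ [v])) =
      {s(u, C.head hC)} + ({s(v, C.getLast hC)} + pathEdges C) := by
    intro u v C hC
    rw [pathEdges_cons_of_ne_nil u (by simp), pathEdges_concat_of_ne_nil v hC,
      List.head_append_left hC, Sym2.eq_swap (a := v)]; abel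
  have hE : pathEdges (α :: (A ++ [β])) + pathEdges (α :: (B ++ [β])) =
      {s(α, A.head hA)} + ({s(β, A.getLast hA)} + pathEdges A +
        {s(α, B.head hB)} + {s(β, B.getLast hB)} + pathEdges B) := by
    rw [e1 α β A hA, e1 α β B hB]; abel
  have hhA := List.head_mem hA
  have hlA := List.getLast_mem hA
  have hhB := List.head_mem hB
  have hlB := List.getLast_mem hB
  have hx : s(β, A.head hA) ∉ pathEdges (α :: (A ++ [β])) + pathEdges (α :: (B ++ [β])) := by
    rw [hE]
    simp only [Multiset.mem_add, Multiset.mem_singleton, not_or]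
    refine ⟨?_, ⟨⟨⟨?_, ?_⟩, ?_⟩, ?_⟩, ?_⟩
    · intro h'
      rcases Sym2.eq_iff.1 h' with ⟨h', -⟩ | ⟨h', -⟩
      · exact hαβ h'.symm
      · exact hβA (h' ▸ hhA)
    · intro h'
      rcases Sym2.eq_iff.1 h' with ⟨-, h'⟩ | ⟨h', -⟩
      · exact h₁ h'
      · exact hβA (h' ▸ hlA)
    · exact notMem_pathEdges_left hβA
    · intro h'
      rcases Sym2.eq_iff.1 h' with ⟨h', -⟩ | ⟨h', -⟩
      · exact hαβ h'.symm
      · exact hβB (h' ▸ hhB)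
    · intro h'
      rcases Sym2.eq_iff.1 h' with ⟨-, h'⟩ | ⟨h', -⟩
      · exact h₂ h'
      · exact hβB (h' ▸ hlB)
    · exact notMem_pathEdges_left hβB
  rw [hE] at h hx
  -- Besides the first edge of `A`, one of the other three end edges of the two paths is switched.
  -- The first edge of `B` gives two closed walks at β, the last edge of `B` one at each twin. With
  -- the last edge of `A`, the interior of that path is merely reversed.
  obtain ⟨y, L', ⟨h1, h2⟩ | ⟨h1, h2⟩⟩ := h.switch hαβ hside hx
  · left
    have hy : s(α, y) ∈ ({s(β, A.getLast hA)} + pathEdges A +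
        {s(α, B.head hB)} + {s(β, B.getLast hB)} + pathEdges B : Multiset (Sym2 X)) := by
      rw [h1]; simp
    simp only [Multiset.mem_add, Multiset.mem_singleton] at hy
    rcases hy with (((hy | hy) | hy) | hy) | hy
    · exfalso
      rcases Sym2.eq_iff.1 hy with ⟨hy, -⟩ | ⟨hy, -⟩
      · exact hαβ hy
      · exact hαA (hy ▸ hlA)
    · exact absurd hy (notMem_pathEdges_left hαA)
    · have hL' : L' = {s(β, A.getLast hA)} + pathEdges A + {s(β, B.getLast hB)} + pathEdges B := by
        rw [hy] at h1
        apply add_left_cancel (a := ({s(α, B.head hB)} : Multiset (Sym2 X)))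
        rw [← h1]; abel
      have hy' : y = B.head hB := Sym2.congr_right.1 hy
      rw [hL', hy'] at h2
      rw [e1 β β A hA, e1 β β B hB]
      convert h2 using 1
      abel
    · exfalso
      rcases Sym2.eq_iff.1 hy with ⟨hy, -⟩ | ⟨hy, -⟩
      · exact hαβ hy
      · exact hαB (hy ▸ hlB)
    · exact absurd hy (notMem_pathEdges_left hαB)
  · right
    have hy : s(β, y) ∈ ({s(β, A.getLast hA)} + pathEdges A +
        {s(α, B.head hB)} + {s(β, B.getLast hB)} + pathEdges B : Multiset (Sym2 X)) := by
      rw [h1]; simp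
    simp only [Multiset.mem_add, Multiset.mem_singleton] at hy
    rcases hy with (((hy | hy) | hy) | hy) | hy
    · right
      have hL' : L' = pathEdges A + {s(α, B.head hB)} + {s(β, B.getLast hB)} + pathEdges B := by
        rw [hy] at h1
        apply add_left_cancel (a := ({s(β, A.getLast hA)} : Multiset (Sym2 X)))
        rw [← h1]; abel
      have hy' : y = A.getLast hA := Sym2.congr_right.1 hy
      rw [hL', hy'] at h2
      rw [e1 β α A hA, e1 α β B hB]
      convert h2 using 1
      abel
    · exact absurd hy (notMem_pathEdges_left hβA)
    · exfalso
      rcases Sym2.eq_iff.1 hy with ⟨hy, -⟩ | ⟨hy, -⟩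
      · exact hαβ hy.symm
      · exact hβB (hy ▸ hhB)
    · left
      have hL' : L' = {s(β, A.getLast hA)} + pathEdges A + {s(α, B.head hB)} + pathEdges B := by
        rw [hy] at h1
        apply add_left_cancel (a := ({s(β, B.getLast hB)} : Multiset (Sym2 X)))
        rw [← h1]; abel
      have hy' : y = B.getLast hB := Sym2.congr_right.1 hy
      rw [hL', hy'] at h2
      rw [e1 β β A hA, e1 α α B hB]
      convert h2 using 1
      abel
    · exact absurd hy (notMem_pathEdges_left hβB)

end TwinHost

lemma List.exists_eq_append_cons_of_lt_length {l : List X} {k : ℕ} (hk : k < l.length) :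
    ∃ l₁ a l₂, l = l₁ ++ a :: l₂ ∧ l₁.length = k :=
  ⟨l.take k, l[k], l.drop (k + 1), by simp, by simp; omega⟩

lemma List.head_ne_getLast_of_nodup {l : List X} (h : l.Nodup) (hl : 2 ≤ l.length) (hne : l ≠ []) :
    l.head hne ≠ l.getLast hne := by
  match l, h, hl with
  | a :: b :: l, h, _ =>
    rw [List.head_cons, List.getLast_cons (by simp)]
    intro h'
    exact (List.nodup_cons.1 h).1 (h' ▸ List.getLast_mem _)

/-! ### Chains of two cycles, and rigidity of leaves of locally minimal excess -/

namespace TwinHost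

variable [DecidableEq X] {H : TwinHost X} {N : Multiset ℕ} {L K : Multiset (Sym2 X)} {n : ℕ}
  {V : Finset X}

/-- There is a packing whose leave is the edge-disjoint union of a `t`-cycle and an `h`-cycle. -/
def HasTwoCycleLeave (H : TwinHost X) (N : Multiset ℕ) (t h : ℕ) : Prop :=
  ∃ C D : List X, C.Nodup ∧ D.Nodup ∧ C.length = t ∧ D.length = h ∧
    H.Leaves N (cycleEdges C + cycleEdges D)

/-- There is a packing whose leave is a closed walk of length `s` with `s - e` vertices. -/
def HasConnectedLeave (H : TwinHost X) (N : Multiset ℕ) (s e : ℕ) : Prop :=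
  ∃ L V, H.Leaves N L ∧ IsClosedWalk L s V ∧ V.card + e = s

lemma Leaves.hasTwoCycleLeave {x y : X} {A B : List X}
    (h : H.Leaves N (pathEdges (x :: (A ++ [x])) + pathEdges (y :: (B ++ [y]))))
    (hA : (x :: A).Nodup) (hB : (y :: B).Nodup) :
    H.HasTwoCycleLeave N (A.length + 1) (B.length + 1) :=
  ⟨x :: A, y :: B, hA, hB, rfl, rfl, h⟩

/-- Switching in a chain of two cycles that share the vertex `c`. -/
lemma Leaves.chain_switch {c α β : X} {S₁ S₂ T₁ T₂ : List X}
    (h : H.Leaves N (pathEdges (c :: ((S₁ ++ α :: S₂) ++ [c])) +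
      pathEdges (c :: ((T₁ ++ β :: T₂) ++ [c]))))
    (hnd : (c :: ((S₁ ++ α :: S₂) ++ (T₁ ++ β :: T₂))).Nodup)
    (heven : Even (S₁.length + T₁.length + 2))
    (h₁ : ¬ (S₁ = [] ∧ T₁ = [])) (h₂ : ¬ (S₁ = [] ∧ T₂ = [])) :
    H.HasTwoCycleLeave N (S₁.length + T₁.length + 2) (S₂.length + T₂.length + 2) ∨
      H.Leaves N (pathEdges (c :: ((T₁ ++ α :: S₂) ++ [c])) +
        pathEdges (c :: ((S₁ ++ β :: T₂) ++ [c]))) := by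
  -- The chain is read as two paths from α to β, both through `c`. Closing them gives cycles of the
  -- lengths asked for, while reversing `A` exchanges `S₁` and `T₁` between the two cycles of the
  -- chain.
  set A := S₁.reverse ++ c :: T₁ with hA
  set B := S₂ ++ c :: T₂.reverse with hB
  have key : ∀ u v w z : X, pathEdges (u :: (A ++ [v])) + pathEdges (w :: (B ++ [z])) =
      (pathEdges (c :: (S₁ ++ [u])) + pathEdges (w :: (S₂ ++ [c]))) +
      (pathEdges (c :: (T₁ ++ [v])) + pathEdges (z :: (T₂ ++ [c]))) := by
    intro u v w z
    rw [hA, hB, List.append_assoc, List.cons_append, pathEdges_cons_append u, List.append_assoc,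
      List.cons_append, pathEdges_cons_append w, pathEdges_reverse_cons_concat,
      pathEdges_reverse_cons_concat]
    abel
  have key2 : ∀ (u v : List X) (w : X), pathEdges (c :: ((u ++ w :: v) ++ [c])) =
      pathEdges (c :: (u ++ [w])) + pathEdges (w :: (v ++ [c])) := by
    intro u v w
    rw [List.append_assoc, List.cons_append, pathEdges_cons_append]
  have hperm1 : (c :: ((S₁ ++ α :: S₂) ++ (T₁ ++ β :: T₂))).Perm
      (β :: (α :: A ++ (S₂ ++ T₂))) := by
    rw [List.perm_iff_count]; intro x; simp [hA, List.count_cons]; omega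
  have hperm2 : (c :: ((S₁ ++ α :: S₂) ++ (T₁ ++ β :: T₂))).Perm
      (β :: (α :: B ++ (S₁ ++ T₁))) := by
    rw [List.perm_iff_count]; intro x; simp [hB, List.count_cons]; omega
  have hn1 := hperm1.nodup_iff.1 hnd
  have hn2 := hperm2.nodup_iff.1 hnd
  have hn1' : (β :: α :: A).Nodup := hn1.sublist (by simp)
  have hn2' : (β :: α :: B).Nodup := hn2.sublist (by simp)
  simp only [List.nodup_cons, List.mem_cons, not_or] at hn1' hn2'
  have hA0 : A ≠ [] := by simp [hA]
  have hB0 : B ≠ [] := by simp [hB]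
  have hleave : H.Leaves N (pathEdges (α :: (A ++ [β])) + pathEdges (α :: (B ++ [β]))) := by
    rw [key]
    rw [key2, key2] at h
    exact h
  have hlen : A.length = S₁.length + T₁.length + 1 := by simp [hA]; omega
  have hlenB : B.length = S₂.length + T₂.length + 1 := by simp [hB]; omega
  have hA2 : 2 ≤ A.length := by
    rw [hlen]
    by_contra h'
    exact h₁ ⟨List.length_eq_zero_iff.1 (by omega), List.length_eq_zero_iff.1 (by omega)⟩
  have hside : H.side α = H.side β :=
    hleave.alternates.left.side_eq (by rw [hlen]; exact heven)
  have hlast : A.head hA0 ≠ B.getLast hB0 := by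
    intro h'
    have hh : A.head hA0 ∈ S₁ ∨ S₁ = [] ∧ A.head hA0 = c := by
      rcases List.eq_nil_or_concat S₁ with h0 | ⟨S, d, h0⟩
      · subst h0; simp [hA]
      · left; subst h0; simp [hA]
    have hl : B.getLast hB0 ∈ T₂ ∨ T₂ = [] ∧ B.getLast hB0 = c := by
      cases T₂ with
      | nil => simp [hB]
      | cons d T => left; simp [hB]
    rw [List.nodup_cons, List.nodup_append] at hnd
    rcases hh with hh | ⟨hh0, hh⟩ <;> rcases hl with hl | ⟨hl0, hl⟩
    · exact hnd.2.2.2 _ (by simp [hh]) _ (by simp [hl]) h'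
    · exact hnd.1 (by rw [← hl, ← h']; simp [hh])
    · exact hnd.1 (by rw [← hh, h']; simp [hl])
    · exact h₂ ⟨hh0, hl0⟩
  have := hleave.close hA0 hB0 hn1'.2.1 hn1'.1.2 hn2'.2.1 hn2'.1.2 (Ne.symm hn1'.1.1) hside
    (List.head_ne_getLast_of_nodup hn1'.2.2 hA2 hA0) hlast
  rw [show S₁.length + T₁.length + 2 = A.length + 1 by omega,
    show S₂.length + T₂.length + 2 = B.length + 1 by omega]
  rcases this with h' | h' | h'
  · left
    exact h'.hasTwoCycleLeave (List.nodup_cons.2 ⟨hn1'.1.2, hn1'.2.2⟩)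
      (List.nodup_cons.2 ⟨hn2'.1.2, hn2'.2.2⟩)
  · left
    exact h'.hasTwoCycleLeave (List.nodup_cons.2 ⟨hn1'.1.2, hn1'.2.2⟩)
      (List.nodup_cons.2 hn2'.2)
  · right
    rw [key] at h'
    rw [key2, key2]
    convert h' using 1
    abel

/-- The leave of a packing is a chain of two cycles: one can choose the lengths. -/
lemma Leaves.hasTwoCycleLeave_of_chain {t h : ℕ} (ht : 4 ≤ t) (hth : t ≤ h) (hte : Even t) {c : X}
    {S T : List X} (hL : H.Leaves N (pathEdges (c :: (S ++ [c])) + pathEdges (c :: (T ++ [c]))))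
    (hnd : (c :: (S ++ T)).Nodup) (hlen : S.length + T.length + 2 = t + h) :
    H.HasTwoCycleLeave N t h := by
  induction hp : S.length using Nat.strong_induction_on generalizing S T with
  | _ p ih =>
    obtain ⟨i, hi⟩ := hL.alternates.left.even (isClosedWalk_pathEdges c S)
    have hT1 := hL.alternates.right.two_le (isClosedWalk_pathEdges c T)
    -- If the first cycle has length 2i < 2t, α is taken opposite to `c`, so `S₁` and `S₂` have
    -- equal length. Then even the outcome that exchanges `S₁` and `T₁` yields cycles of lengths t
    -- and h.
    by_cases hpt : S.length + 1 < 2 * t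
    · obtain ⟨S₁, α, S₂, rfl, hS₁⟩ := List.exists_eq_append_cons_of_lt_length
        (l := S) (k := i - 1) (by omega)
      simp only [List.length_append, List.length_cons] at hlen hi hpt hp
      obtain ⟨T₁, β, T₂, rfl, hT₁⟩ := List.exists_eq_append_cons_of_lt_length
        (l := T) (k := t - i - 1) (by omega)
      simp only [List.length_append, List.length_cons] at hlen
      have e1 : S₁.length + T₁.length + 2 = t := by omega
      have e2 : S₂.length + T₂.length + 2 = h := by omega
      have := hL.chain_switch hnd (e1 ▸ hte)
        (by rintro ⟨rfl, rfl⟩; simp at e1; omega)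
        (by rintro ⟨rfl, rfl⟩; simp at *; omega)
      rw [e1, e2] at this
      rcases this with h' | h'
      · exact h'
      · have hperm1 : (c :: ((S₁ ++ α :: S₂) ++ (T₁ ++ β :: T₂))).Perm
            ((c :: (T₁ ++ α :: S₂)) ++ (S₁ ++ β :: T₂)) := by
          rw [List.perm_iff_count]; intro x; simp [List.count_cons]; omega
        have hperm2 : (c :: ((S₁ ++ α :: S₂) ++ (T₁ ++ β :: T₂))).Perm
            ((c :: (S₁ ++ β :: T₂)) ++ (T₁ ++ α :: S₂)) := by
          rw [List.perm_iff_count]; intro x; simp [List.count_cons]; omega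
        have := h'.hasTwoCycleLeave
          ((List.nodup_append.1 (hperm1.nodup_iff.1 hnd)).1)
          ((List.nodup_append.1 (hperm2.nodup_iff.1 hnd)).1)
        convert this using 1
        · simp; omega
        · simp; omega
    -- If the first cycle is longer, exchanging the t - 2 vertices of `S₁` with the empty `T₁`
    -- shortens it by t - 2 > 0, and induction applies.
    · obtain ⟨S₁, α, S₂, rfl, hS₁⟩ := List.exists_eq_append_cons_of_lt_length
        (l := S) (k := t - 2) (by omega)
      obtain ⟨T₁, β, T₂, rfl, hT₁⟩ := List.exists_eq_append_cons_of_lt_length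
        (l := T) (k := 0) (by omega)
      simp only [List.length_append, List.length_cons] at hlen hi hpt hp
      have e1 : S₁.length + T₁.length + 2 = t := by omega
      have e2 : S₂.length + T₂.length + 2 = h := by omega
      have := hL.chain_switch hnd (e1 ▸ hte)
        (by rintro ⟨rfl, rfl⟩; simp at e1; omega)
        (by rintro ⟨rfl, rfl⟩; simp at hS₁; omega)
      rw [e1, e2] at this
      rcases this with h' | h'
      · exact h'
      · refine ih (T₁ ++ α :: S₂).length (by simp; omega) h' ?_ (by simp; omega) rfl
        have hperm : (c :: ((S₁ ++ α :: S₂) ++ (T₁ ++ β :: T₂))).Perm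
            (c :: ((T₁ ++ α :: S₂) ++ (S₁ ++ β :: T₂))) := by
          rw [List.perm_iff_count]; intro x; simp [List.count_cons]; omega
        exact hperm.nodup_iff.1 hnd

/-- In a connected leave of which the excess cannot be reduced by one, any closed subwalk with
distinct vertices hangs at one vertex, and can be moved to any other vertex. -/
lemma Leaves.exists_move {x γ : X} {l : List X} {e : ℕ}
    (h : H.Leaves N (pathEdges (x :: (l ++ [x])) + K)) (hl : (x :: l).Nodup)
    (hK : IsClosedWalk K n V) (hx : x ∈ V) (he : 1 ≤ e)
    (hcard : (V ∪ l.toFinset).card + e = n + l.length + 1)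
    (hno : ¬ H.HasConnectedLeave N (n + l.length + 1) (e - 1))
    (hside : H.side x = H.side γ) (hγV : γ ∉ V) (hγl : γ ∉ l) :
    (∀ z ∈ l, z ∉ V) ∧ ∀ y ∈ V, ∃ Y : List X, Y.length = l.length ∧ (y :: Y).Nodup ∧
      (∀ z ∈ Y, z ∉ V) ∧ H.Leaves N (pathEdges (y :: (Y ++ [y])) + K) := by
  have hl0 : l ≠ [] := by
    rintro rfl
    exact h.side_ne (show s(x, x) ∈ _ by simp) rfl
  have hxl := List.nodup_cons.1 hl
  have hcardγ : (insert γ (V ∪ l.toFinset)).card + (e - 1) = n + l.length + 1 := by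
    rw [Finset.card_insert_of_notMem (by simp [hγV, hγl])]; omega
  -- A connected result would contain the additional vertex γ and hence have smaller excess. So the
  -- loop moves to γ, and for the same reason it must then be disjoint from the rest.
  obtain h1 | ⟨L, hL, hL'⟩ := h.split hl0 hxl.1 hK (by rintro rfl; exact hγV hx) hside hγl hγV
  swap
  · exact absurd ⟨L, _, hL, hL', hcardγ⟩ hno
  have hdisj : ∀ z ∈ l, z ∉ V := by
    intro z hz hzV
    refine hno ⟨_, _, h1, ?_, hcardγ⟩
    convert (isClosedWalk_pathEdges γ l).add hK (x := z) (by simp [hz]) hzV using 1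
    · omega
    · ext y; simp; tauto
  refine ⟨hdisj, fun y hy => ?_⟩
  -- The detached loop can be attached at `y` by any of its vertices on the side of `y`. Joining it
  -- to the walk in the other way would again add γ and lower the excess.
  obtain ⟨z, hz, hzy⟩ := h1.alternates.left.exists_mem_side (isClosedWalk_pathEdges γ l) (H.side y)
  obtain ⟨Y, hY1, hY2, hY3⟩ := (isClosedWalk_pathEdges γ l).exists_base hz
  have hYl : Y.length = l.length := by omega
  have hYn : (z :: Y).Nodup := by
    rw [← Multiset.coe_nodup, ← Multiset.toFinset_card_eq_card_iff_nodup]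
    change (z :: Y).toFinset.card = (z :: Y).length
    rw [← hY3, List.toFinset_card_of_nodup (List.nodup_cons.2 ⟨hγl, hxl.2⟩)]
    simp [hYl]
  have hmem : ∀ w ∈ z :: Y, w ∉ V := by
    intro w hw
    rw [← List.mem_toFinset, ← hY3, List.mem_toFinset, List.mem_cons] at hw
    rcases hw with rfl | hw
    · exact hγV
    · exact hdisj w hw
  rw [hY1] at h1
  obtain h2 | ⟨L, hL, hL'⟩ := h1.attach (by rintro rfl; exact hl0 (by simpa using hYl.symm))
    (List.nodup_cons.1 hYn).1 hK hy hzy hmem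
  swap
  · refine absurd ⟨L, _, hL, hYl ▸ hL', ?_⟩ hno
    rw [← hcardγ]
    congr 2
    have : insert z (V ∪ Y.toFinset) = V ∪ (z :: Y).toFinset := by ext w; simp
    rw [this, ← hY3]
    ext w; simp
  exact ⟨Y, hYl, List.nodup_cons.2 ⟨fun h' => hmem y (by simp [h']) hy, (List.nodup_cons.1 hYn).2⟩,
    fun w hw => hmem w (by simp [hw]), h2⟩

/-- Each coincidence of vertices on a side improves the bound on the number of vertices used there
by one. -/
lemma card_onSide_union_add_inter (b : Bool) (V W : Finset X) :
    (H.onSide b (V ∪ W)).card + (H.onSide b (V ∩ W)).card =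
      (H.onSide b V).card + (H.onSide b W).card := by
  have : H.onSide b (V ∩ W) = H.onSide b V ∩ H.onSide b W := by
    ext x; simp only [mem_onSide, Finset.mem_inter]; tauto
  rw [this, onSide_union, Finset.card_union_add_card_inter]

lemma one_le_card_onSide {b : Bool} {x : X} (hx : x ∈ V) (hb : H.side x = b) :
    1 ≤ (H.onSide b V).card :=
  Finset.card_pos.2 ⟨x, mem_onSide.2 ⟨hx, hb⟩⟩

lemma exists_notMem_of_card_lt [Fintype X] {b : Bool}
    (h : (H.onSide b V).card < (H.onSide b Finset.univ).card) : ∃ γ, H.side γ = b ∧ γ ∉ V := by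
  by_contra! h'
  refine absurd (Finset.card_le_card ?_) (not_le.2 h)
  intro x hx
  rw [mem_onSide] at hx ⊢
  exact ⟨h' x hx.2, hx.2⟩

lemma card_onSide_add (V : Finset X) (b : Bool) :
    (H.onSide b V).card + (H.onSide (!b) V).card = V.card := by
  have : H.onSide (!b) V = V.filter (¬ H.side · = b) := by
    ext x; simp only [mem_onSide, Finset.mem_filter]
    cases H.side x <;> cases b <;> simp
  rw [this, onSide, Finset.card_filter_add_card_filter_not]

end TwinHost

/-! ### Closed walks with ears -/

namespace TwinHost

variable [DecidableEq X] {H : TwinHost X} {N : Multiset ℕ} {L K : Multiset (Sym2 X)} {n : ℕ}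
  {V : Finset X}

/-- The sides of the host are large enough for leaves with `s` edges. -/
def IsSpacious [Fintype X] (H : TwinHost X) (b : Bool) (s : ℕ) : Prop :=
  s ≤ 2 * (H.onSide (!b) Finset.univ).card ∧ s ≤ 2 * (H.onSide b Finset.univ).card + 2

/-- On the side `!b`, one vertex fewer than s/2 has to be used; on `b`, which may have only s/2 - 1
vertices, two fewer. -/
lemma IsSpacious.exists_notMem [Fintype X] {b b' : Bool} {s : ℕ} (h : H.IsSpacious b s)
    {W : Finset X} (h₁ : 2 * (H.onSide b' W).card + 2 ≤ s)
    (h₂ : b' = b → 2 * (H.onSide b' W).card + 4 ≤ s) : ∃ γ, H.side γ = b' ∧ γ ∉ W := by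
  apply exists_notMem_of_card_lt
  obtain ⟨h3, h4⟩ := h
  by_cases hb : b' = b
  · have := h₂ hb; subst hb; omega
  · have : b' = !b := by cases b <;> cases b' <;> simp_all
    subst this; omega

/-- A leave with `s` edges and excess `e` that consists of a closed walk `K` through `α` with
`n` edges and excess `r`, and two paths `α A β` and `α B β` that leave the walk at `α`. -/
structure IsWalkWithEars (H : TwinHost X) (N : Multiset ℕ) (b : Bool) (s e n r : ℕ)
    (K : Multiset (Sym2 X)) (V : Finset X) (α : X) (A B : List X) (β : X) : Prop where
  leaves : H.Leaves N (K + (pathEdges (α :: (A ++ [β])) + pathEdges (α :: (B ++ [β]))))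
  walk : IsClosedWalk K n V
  mem : α ∈ V
  side_eq : H.side α = b
  card_add : V.card + r = n
  nodup_left : (β :: A).Nodup
  nodup_right : (β :: B).Nodup
  left_notMem : ∀ z ∈ A, z ∉ V
  right_notMem : ∀ z ∈ B, z ∉ V
  notMem : β ∉ V
  length_eq : n + A.length + B.length + 2 = s
  card_union : (V ∪ (A ++ β :: B).toFinset).card + e = s

lemma isClosedWalk_ears (α β : X) (A B : List X) :
    IsClosedWalk (pathEdges (α :: (A ++ [β])) + pathEdges (α :: (B ++ [β])))
      (A.length + B.length + 2) (insert α (A ++ β :: B).toFinset) := by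
  refine ⟨α, A ++ β :: B.reverse, ?_, by simp; omega, by ext; simp⟩
  rw [List.append_assoc, List.cons_append, pathEdges_cons_append α A (B.reverse ++ [α]) β,
    pathEdges_reverse_cons_concat]

namespace IsWalkWithEars

variable {b : Bool} {s e r : ℕ} {α β : X} {A B : List X}

/-- Moving a loop of the walk to the common end `β` of the ears. -/
lemma exists_step [Fintype X] (hs : H.IsSpacious b s)
    (h : H.IsWalkWithEars N b s e n r K V α A B β) (hr : 1 ≤ r) (he : 1 ≤ e)
    (hno : ¬ H.HasConnectedLeave N s (e - 1)) :
    ∃ z, 2 ≤ z ∧ z ≤ n ∧ ∀ k, 1 ≤ k → k + 1 ≤ z → ∃ K' V' A' B' β',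
      H.IsWalkWithEars N b s e (n - z) (r - 1) K' V' α A' B' β' ∧
      A'.length = A.length + k ∧ ∃ w ∈ A', w ∈ B' := by
  obtain ⟨S, hKS, hn, hVS⟩ := h.walk.exists_base h.mem
  have hnd : ¬ ((α :: S).filter (fun _ => decide True)).Nodup := by
    intro h'
    simp only [decide_true, List.filter_true] at h'
    have h1 := List.toFinset_card_of_nodup h'
    rw [← hVS, List.length_cons] at h1
    have := h.card_add
    omega
  obtain ⟨l₁, x, l, l₃, hW, -, hxl, hl⟩ := List.exists_repeat (fun _ => True) _ hnd
  simp only [decide_true, List.filter_true] at hl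
  obtain ⟨K', V', hK', hw, hV', hα, hx, hVl, hSl⟩ := isClosedWalk_cut hW
  rw [← hKS] at hK'
  rw [← hVS] at hVl
  have hL := h.leaves
  have hww := hw.add (isClosedWalk_ears α β A B) hα (by simp)
  rw [hK', add_assoc] at hL
  set W := V' ∪ insert α (A ++ β :: B).toFinset with hWdef
  have hWl : W ∪ l.toFinset = V ∪ (A ++ β :: B).toFinset := by
    ext y; have : y = α → y ∈ V' := by rintro rfl; exact hα
    simp only [hWdef, hVl, Finset.mem_union, Finset.mem_insert]; tauto
  have hlen := h.length_eq
  have hl1 := hL.alternates.left.two_le (isClosedWalk_pathEdges x l)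
  -- The leave is covered by three closed walks with s edges in all: the loop, the rest of the walk,
  -- and the ears. The coincidence at `x` yields a spare vertex on side `!b`. On side `b` the one at
  -- α is needed as well, which is why α is required to lie on `b`.
  obtain ⟨γ, hγ, hγW⟩ : ∃ γ, H.side γ = H.side x ∧ γ ∉ W ∪ l.toFinset := by
    have e1 := hL.alternates.left.two_mul_card_onSide_le (isClosedWalk_pathEdges x l) (H.side x)
    have e2 := hL.alternates.right.left.two_mul_card_onSide_le hw (H.side x)
    have e3 := hL.alternates.right.right.two_mul_card_onSide_le (isClosedWalk_ears α β A B)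
      (H.side x)
    have e4 := card_onSide_union_add_inter (H := H) (H.side x) V' (insert α (A ++ β :: B).toFinset)
    have e5 := card_onSide_union_add_inter (H := H) (H.side x) W (x :: l).toFinset
    have e6 : 1 ≤ (H.onSide (H.side x) (W ∩ (x :: l).toFinset)).card :=
      one_le_card_onSide (x := x) (by simp [hWdef, hx]) rfl
    have e7 : H.side x = b →
        1 ≤ (H.onSide (H.side x) (V' ∩ insert α (A ++ β :: B).toFinset)).card :=
      fun h' => one_le_card_onSide (x := α) (by simp [hα]) (by rw [h.side_eq, h'])
    have e8 : W ∪ l.toFinset = W ∪ (x :: l).toFinset := by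
      ext y; have : y = x → y ∈ W := by rintro rfl; simp [hWdef, hx]
      simp only [Finset.mem_union, List.mem_toFinset, List.mem_cons]; tauto
    rw [← e8] at e5
    rw [← hWdef] at e4
    exact hs.exists_notMem (by omega) (fun h' => by have := e7 h'; omega)
  rw [Finset.mem_union, not_or, List.mem_toFinset] at hγW
  have hsum : l₁.length + l₃.length + 1 + (A.length + B.length + 2) + l.length + 1 = s := by omega
  obtain ⟨hdisj, hmove⟩ := hL.exists_move (e := e) (γ := γ) (List.nodup_cons.2 ⟨hxl, hl⟩) hww
    (Finset.mem_union_left _ hx) he (by rw [hWl, h.card_union, hsum]) (by rw [hsum]; exact hno) hγ.symm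
    hγW.1 hγW.2
  -- The loop is hung at β and cut at its `k`-th vertex β', the new common end. Its two arcs prolong
  -- the ears, which now share β.
  obtain ⟨Y, hYl, hYn, hYW, hY⟩ := hmove β (by simp [hWdef])
  have hcV : V.card = V'.card + l.length := by
    rw [hVl, Finset.card_union_of_disjoint, List.toFinset_card_of_nodup hl]
    rw [Finset.disjoint_left]
    intro y hy hyl
    exact hdisj y (List.mem_toFinset.1 hyl) (by simp [hWdef, hy])
  have hcW : (W ∪ l.toFinset).card = W.card + l.length := by
    rw [Finset.card_union_of_disjoint, List.toFinset_card_of_nodup hl]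
    rw [Finset.disjoint_left]
    exact fun y hy hyl => hdisj y (List.mem_toFinset.1 hyl) hy
  have hcY : (W ∪ Y.toFinset).card = W.card + l.length := by
    rw [Finset.card_union_of_disjoint, List.toFinset_card_of_nodup (List.nodup_cons.1 hYn).2, hYl]
    rw [Finset.disjoint_left]
    exact fun y hy hyl => hYW y (List.mem_toFinset.1 hyl) hy
  have hcard := h.card_add
  have hVV' : ∀ y, y ∉ V → y ∉ V' := fun y hy hy' => hy (by rw [hVl]; simp [hy'])
  refine ⟨l.length + 1, hl1, by omega, fun k hk hkl => ?_⟩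
  obtain ⟨A₁, β', B₁, rfl, hA₁⟩ := List.exists_eq_append_cons_of_lt_length (l := Y) (k := k - 1)
    (by omega)
  have hYn' := List.nodup_cons.1 hYn
  have hlY : A₁.length + B₁.length + 1 = l.length := by rw [← hYl]; simp; omega
  have hYV : ∀ y ∈ A₁ ++ β' :: B₁, y ∉ V' ∧ y ∉ A ∧ y ≠ β ∧ y ∉ B := by
    intro y hy
    have := hYW y hy
    simp only [hWdef, Finset.mem_union, Finset.mem_insert, List.mem_toFinset, List.mem_append,
      List.mem_cons, not_or] at this
    tauto
  have hperm : ((A₁ ++ β' :: B₁)).Perm (β' :: (A₁ ++ B₁)) := List.perm_middle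
  have hpn := hperm.nodup_iff.1 hYn'.2
  rw [List.nodup_cons, List.nodup_append] at hpn
  refine ⟨K', V', A ++ β :: A₁, B ++ β :: B₁.reverse, β', ⟨?_, ?_, hα, h.side_eq, by omega, ?_, ?_,
    ?_, ?_, ?_, ?_, ?_⟩, by simp; omega, β, by simp, by simp⟩
  · rw [List.append_assoc, List.cons_append, pathEdges_cons_append, List.append_assoc,
      List.cons_append, pathEdges_cons_append α B, pathEdges_reverse_cons_concat]
    rw [List.append_assoc, List.cons_append, pathEdges_cons_append] at hY
    convert hY using 1
    abel
  · convert hw using 1; omega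
  · have h1 := h.nodup_left
    have h2 : (β' :: (A ++ β :: A₁)).Perm (β :: A ++ β' :: A₁) := by
      rw [List.perm_iff_count]; intro y; simp [List.count_cons]; omega
    rw [h2.nodup_iff, List.nodup_append]
    refine ⟨h1, List.nodup_cons.2 ⟨fun h' => hpn.1 (by simp [h']), hpn.2.1⟩, ?_⟩
    rintro y hy z hz rfl
    have := hYV y (by simp only [List.mem_cons, List.mem_append] at hz ⊢; tauto)
    simp only [List.mem_cons] at hy; tauto
  · have h1 := h.nodup_right
    have h2 : (β' :: (B ++ β :: B₁.reverse)).Perm (β :: B ++ β' :: B₁) := by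
      rw [List.perm_iff_count]; intro y; simp [List.count_cons]; omega
    rw [h2.nodup_iff, List.nodup_append]
    refine ⟨h1, List.nodup_cons.2 ⟨fun h' => hpn.1 (by simp [h']), hpn.2.2.1⟩, ?_⟩
    rintro y hy z hz rfl
    have := hYV y (by simp only [List.mem_cons, List.mem_append] at hz ⊢; tauto)
    simp only [List.mem_cons] at hy; tauto
  · intro y hy
    rw [List.mem_append, List.mem_cons] at hy
    rcases hy with hy | rfl | hy
    · exact hVV' y (h.left_notMem y hy)
    · exact hVV' y h.notMem
    · exact (hYV y (by simp [hy])).1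
  · intro y hy
    rw [List.mem_append, List.mem_cons, List.mem_reverse] at hy
    rcases hy with hy | rfl | hy
    · exact hVV' y (h.right_notMem y hy)
    · exact hVV' y h.notMem
    · exact (hYV y (by simp [hy])).1
  · exact (hYV β' (by simp)).1
  · simp; omega
  · have : V' ∪ (A ++ β :: A₁ ++ β' :: (B ++ β :: B₁.reverse)).toFinset =
        W ∪ (A₁ ++ β' :: B₁).toFinset := by
      ext y; have : y = α → y ∈ V' := by rintro rfl; exact hα
      simp only [hWdef, Finset.mem_union, Finset.mem_insert, List.mem_toFinset, List.mem_append,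
        List.mem_cons, List.mem_reverse]; grind
    rw [this, hcY, ← hcW, hWl, h.card_union]

/-- The walk is long in comparison with its excess. -/
lemma two_mul_le [Fintype X] (hs : H.IsSpacious b s)
    (h : H.IsWalkWithEars N b s e n r K V α A B β) (he : 1 ≤ e)
    (hno : ¬ H.HasConnectedLeave N s (e - 1)) : 2 * (r + 1) ≤ n := by
  induction r generalizing n K V A B β with
  | zero => exact h.leaves.alternates.left.two_le h.walk
  | succ r ih =>
    -- Each step removes at least two edges from the walk and one from its excess; a closed walk
    -- with at least two edges remains.
    obtain ⟨z, hz, hzn, hk⟩ := h.exists_step hs (by omega) he hno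
    obtain ⟨K', V', A', B', β', h', -⟩ := hk 1 le_rfl hz
    have := ih h'
    omega

end IsWalkWithEars

end TwinHost

namespace TwinHost

variable [DecidableEq X] [Fintype X] {H : TwinHost X} {N : Multiset ℕ} {L K : Multiset (Sym2 X)}
  {n : ℕ} {V : Finset X} {b : Bool} {s e r t h : ℕ} {α β : X} {A B : List X}

/-- Splitting a leave that consists of two closed walks sharing the vertices `w` and `α`. -/
lemma Leaves.hasConnectedLeave_of_mem_of_mem (hs : H.IsSpacious b s) {w : X} {S T : List X}
    (h : H.Leaves N (pathEdges (w :: (S ++ [w])) + pathEdges (w :: (T ++ [w])))) (hwS : w ∉ S)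
    (hαS : α ∈ S) (hαT : α ∈ T) (hαw : α ≠ w) (hαb : H.side α = b)
    (hST : T.length + S.length + 2 = s) (he : 1 ≤ e)
    (hunion : ((w :: T).toFinset ∪ S.toFinset).card + e = s) :
    H.HasConnectedLeave N s (e - 1) := by
  -- The two walks meet in `w`. If `w` is on the tight side `b`, then α is a second common vertex on
  -- that side. Thus there is a spare twin of `w`.
  obtain ⟨γ, hγ, hγW⟩ : ∃ γ, H.side γ = H.side w ∧ γ ∉ (w :: T).toFinset ∪ S.toFinset := by
    have e1 := h.alternates.left.two_mul_card_onSide_le (isClosedWalk_pathEdges w S) (H.side w)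
    have e2 := h.alternates.right.two_mul_card_onSide_le (isClosedWalk_pathEdges w T) (H.side w)
    have e3 := card_onSide_union_add_inter (H := H) (H.side w) (w :: T).toFinset (w :: S).toFinset
    have e4 : (w :: T).toFinset ∪ S.toFinset = (w :: T).toFinset ∪ (w :: S).toFinset := by
      ext y; simp
    rw [← e4] at e3
    have hwi : w ∈ (w :: T).toFinset ∩ (w :: S).toFinset := by simp
    have e5 := one_le_card_onSide hwi (rfl : H.side w = H.side w)
    have e6 : H.side w = b →
        2 ≤ (H.onSide (H.side w) ((w :: T).toFinset ∩ (w :: S).toFinset)).card := by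
      intro hwb
      rw [← Finset.card_pair (hαw.symm)]
      refine Finset.card_le_card ?_
      intro y hy
      rw [Finset.mem_insert, Finset.mem_singleton] at hy
      rw [mem_onSide]
      rcases hy with rfl | rfl
      · exact ⟨hwi, rfl⟩
      · exact ⟨by simp [hαS, hαT], by rw [hαb, hwb]⟩
    exact hs.exists_notMem (by omega) (fun hh => by have := e6 hh; omega)
  have hcard : (insert γ ((w :: T).toFinset ∪ S.toFinset)).card + (e - 1) = s := by
    rw [Finset.card_insert_of_notMem hγW]
    omega
  rw [Finset.mem_union, not_or] at hγW
  have hγS : γ ∉ S := by simpa using hγW.2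
  obtain h1 | ⟨L, hL, hL'⟩ := h.split (List.ne_nil_of_mem hαS) hwS (isClosedWalk_pathEdges w T)
    (by rintro rfl; exact hγW.1 (by simp)) hγ.symm hγS hγW.1
  -- After the first walk has moved from `w` to γ, the two still meet in α.
  · refine ⟨_, _, h1, ?_, hcard⟩
    convert (isClosedWalk_pathEdges γ S).add (isClosedWalk_pathEdges w T) (x := α)
      (by simp [hαS]) (by simp [hαT]) using 1
    · omega
    · ext y; simp; tauto
  · refine ⟨L, _, hL, ?_, hcard⟩
    convert hL' using 1
    omega

namespace IsWalkWithEars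

/-- If the walk is a cycle, then the leave can be switched to a pair of cycles. -/
lemma hasTwoCycleLeave (hs : H.IsSpacious b s)
    (hw : H.IsWalkWithEars N b s e n 0 K V α A B β) (he : 1 ≤ e)
    (hno : ¬ H.HasConnectedLeave N s (e - 1)) (hAB : ∃ w ∈ A, w ∈ B) (hth : t + h = s)
    (ht : 4 ≤ t) (hte : Even t) (h₁ : A.length + 2 ≤ t) (h₂ : t + 1 ≤ n + A.length + 1) :
    H.HasTwoCycleLeave N t h := by
  obtain ⟨R, rfl, hn, hV⟩ := hw.walk.exists_base hw.mem
  have hR : (α :: R).Nodup := by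
    rw [← Multiset.coe_nodup, ← Multiset.toFinset_card_eq_card_iff_nodup]
    change (α :: R).toFinset.card = (α :: R).length
    rw [← hV, List.length_cons, ← hn, ← hw.card_add, add_zero]
  -- The vertex α' on the cycle is chosen such that the path from α' through `R₁`, α and `A` to β
  -- has t edges. The remaining edges form a path from α' to β with h edges, also through α.
  obtain ⟨R₁, α', R₂, rfl, hR₁⟩ := List.exists_eq_append_cons_of_lt_length (l := R)
    (k := t - (A.length + 1) - 1) (by omega)
  have hlen := hw.length_eq
  have hL := hw.leaves
  have hVmem : ∀ y, y ∈ V ↔ y = α ∨ y ∈ R₁ ∨ y = α' ∨ y ∈ R₂ := by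
    intro y; rw [hV]; simp; tauto
  obtain ⟨w, hwA, hwB⟩ := hAB
  set C := R₁.reverse ++ α :: A with hC
  set D := R₂ ++ α :: B with hD
  have hClen : C.length + 1 = t := by simp [hC]; omega
  have hDlen : D.length + 1 = h := by simp [hD] at hn ⊢; omega
  have key : pathEdges (α :: ((R₁ ++ α' :: R₂) ++ [α])) +
      (pathEdges (α :: (A ++ [β])) + pathEdges (α :: (B ++ [β]))) =
      pathEdges (α' :: (C ++ [β])) + pathEdges (α' :: (D ++ [β])) := by
    rw [hC, hD, List.append_assoc, List.cons_append, pathEdges_cons_append α R₁ (R₂ ++ [α]) α',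
      List.append_assoc, List.cons_append, pathEdges_cons_append α' R₁.reverse (A ++ [β]) α,
      List.append_assoc, List.cons_append, pathEdges_cons_append α' R₂ (B ++ [β]) α,
      pathEdges_reverse_cons_concat]
    abel
  rw [key] at hL
  have hRn : (α' :: (α :: (R₁ ++ R₂))).Nodup := by
    have : (α :: (R₁ ++ α' :: R₂)).Perm (α' :: (α :: (R₁ ++ R₂))) := by
      rw [List.perm_iff_count]; intro y; simp [List.count_cons]; omega
    exact this.nodup_iff.1 hR
  have hnA := hw.nodup_left
  have hnB := hw.nodup_right
  have hβV := hw.notMem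
  have hCn : (α' :: β :: C).Nodup := by
    have h1 : (α' :: β :: C).Perm ((α' :: α :: R₁) ++ (β :: A)) := by
      rw [List.perm_iff_count]; intro y; simp [hC, List.count_cons]; omega
    rw [h1.nodup_iff, List.nodup_append]
    refine ⟨hRn.sublist (by simp), hnA, ?_⟩
    rintro y hy z hz rfl
    have h2 : y ∈ V := by rw [hVmem]; simp only [List.mem_cons] at hy; tauto
    rcases List.mem_cons.1 hz with rfl | hz
    · exact hβV h2
    · exact hw.left_notMem y hz h2
  have hDn : (α' :: β :: D).Nodup := by
    have h1 : (α' :: β :: D).Perm ((α' :: α :: R₂) ++ (β :: B)) := by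
      rw [List.perm_iff_count]; intro y; simp [hD, List.count_cons]; omega
    rw [h1.nodup_iff, List.nodup_append]
    refine ⟨hRn.sublist (by simp), hnB, ?_⟩
    rintro y hy z hz rfl
    have h2 : y ∈ V := by rw [hVmem]; simp only [List.mem_cons] at hy; tauto
    rcases List.mem_cons.1 hz with rfl | hz
    · exact hβV h2
    · exact hw.right_notMem y hz h2
  have hCn' := hCn
  have hDn' := hDn
  simp only [List.nodup_cons, List.mem_cons, not_or] at hCn' hDn'
  have hC0 : C ≠ [] := by simp [hC]
  have hD0 : D ≠ [] := by simp [hD]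
  have hB0 : B ≠ [] := List.ne_nil_of_mem hwB
  -- Evenness of t is what makes α' and β twins.
  have hside : H.side α' = H.side β := hL.alternates.left.side_eq (by rw [hClen]; exact hte)
  have hCD : C.head hC0 ≠ D.getLast hD0 := by
    have h1 : C.head hC0 ∈ V := by
      rw [hVmem]
      rcases List.eq_nil_or_concat R₁ with h0 | ⟨S, d, h0⟩
      · subst h0; simp [hC]
      · subst h0; simp [hC]
    have h2 : D.getLast hD0 ∈ B := by
      obtain ⟨B', d, rfl⟩ := (List.eq_nil_or_concat B).resolve_left hB0
      simp [hD]
    intro h'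
    exact hw.right_notMem _ h2 (h' ▸ h1)
  obtain h' | h' | h' := hL.close hC0 hD0 hCn'.1.2 hCn'.2.1 hDn'.1.2 hDn'.2.1 hCn'.1.1 hside
    (List.head_ne_getLast_of_nodup hCn'.2.2 (by omega) hC0) hCD
  · rw [← hClen, ← hDlen]
    exact h'.hasTwoCycleLeave (List.nodup_cons.1 hCn).2 (List.nodup_cons.1 hDn).2
  · rw [← hClen, ← hDlen]
    exact h'.hasTwoCycleLeave (List.nodup_cons.1 hCn).2 (List.nodup_cons.2 ⟨hDn'.1.2, hDn'.2.2⟩)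
  -- The last outcome reverses the first path. As the ears share `w`, the leave then splits at `w`
  -- into two closed walks, one along each of the two arcs `R₂` and `R₁`. Both contain α, so the
  -- excess could be lowered.
  exfalso
  obtain ⟨A₁, A₂, rfl⟩ := List.append_of_mem hwA
  obtain ⟨B₁, B₂, rfl⟩ := List.append_of_mem hwB
  have key2 : pathEdges (β :: (C ++ [α'])) + pathEdges (α' :: (D ++ [β])) =
      pathEdges (w :: ((A₂ ++ α' :: (R₂ ++ α :: B₁)) ++ [w])) +
      pathEdges (w :: ((B₂ ++ β :: (R₁.reverse ++ α :: A₁)) ++ [w])) := by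
    have e1 : C ++ [α'] = (R₁.reverse ++ α :: A₁) ++ w :: (A₂ ++ [α']) := by simp [hC]
    have e2 : D ++ [β] = (R₂ ++ α :: B₁) ++ w :: (B₂ ++ [β]) := by simp [hD]
    rw [e1, e2, pathEdges_cons_append β _ (A₂ ++ [α']) w, pathEdges_cons_append α' _ (B₂ ++ [β]) w,
      List.append_assoc A₂, List.cons_append, pathEdges_cons_append w A₂ (R₂ ++ α :: B₁ ++ [w]) α',
      List.append_assoc B₂, List.cons_append, pathEdges_cons_append w B₂ (R₁.reverse ++ α :: A₁ ++ [w]) β]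
    abel
  rw [key2] at h'
  set S := A₂ ++ α' :: (R₂ ++ α :: B₁) with hS
  set T := B₂ ++ β :: (R₁.reverse ++ α :: A₁) with hT
  have hwV := hw.left_notMem w hwA
  have hwS : w ∉ S := by
    have h1 := (List.nodup_cons.1 hnA).2
    have h2 := (List.nodup_cons.1 hnB).2
    rw [List.nodup_append] at h1 h2
    have h3 : w ∉ A₂ := (List.nodup_cons.1 h1.2.1).1
    have h4 : w ∉ B₁ := fun hh => h2.2.2 w hh w (by simp) rfl
    rw [hVmem] at hwV
    simp only [hS, List.mem_append, List.mem_cons]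
    tauto
  have hunion : (w :: T).toFinset ∪ S.toFinset =
      V ∪ ((A₁ ++ w :: A₂) ++ β :: (B₁ ++ w :: B₂)).toFinset := by
    ext y
    simp only [Finset.mem_union, List.mem_toFinset, hVmem, hS, hT, List.mem_append, List.mem_cons,
      List.mem_reverse]
    grind
  have hST : T.length + S.length + 2 = s := by
    simp [hS, hT] at hlen hn ⊢; omega
  refine hno (h'.hasConnectedLeave_of_mem_of_mem hs hwS (α := α) (by simp [hS]) (by simp [hT])
    (by rintro rfl; exact hwV hw.mem) hw.side_eq hST he ?_)
  rw [hunion, hw.card_union]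

/-- A leave with ears can be switched to a pair of cycles. -/
lemma hasTwoCycleLeave_of_le (hs : H.IsSpacious b s)
    (hw : H.IsWalkWithEars N b s e n r K V α A B β) (he : 1 ≤ e)
    (hno : ¬ H.HasConnectedLeave N s (e - 1)) (hAB : r = 0 → ∃ w ∈ A, w ∈ B) (hth : t + h = s)
    (ht : 4 ≤ t) (hte : Even t) (h₁ : A.length + r + 2 ≤ t) (h₂ : t + r ≤ n + A.length) :
    H.HasTwoCycleLeave N t h := by
  induction r generalizing n K V A B β with
  | zero => exact hw.hasTwoCycleLeave hs he hno (hAB rfl) hth ht hte (by omega) (by omega)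
  | succ r ih =>
    obtain ⟨z, hz, hzn, hk⟩ := hw.exists_step hs (by omega) he hno
    have hb : 2 * (r + 1) ≤ n - z := by
      obtain ⟨K', V', A', B', β', h', -⟩ := hk 1 le_rfl hz
      exact h'.two_mul_le hs he hno
    -- Of the admissible lengths, the least `k` is chosen for which the second inequality survives
    -- the step. If `k > 1` that inequality becomes an equality, and then the first one amounts to
    -- `hb`.
    obtain ⟨k, hk1, hkz, hk2, hk3⟩ : ∃ k, 1 ≤ k ∧ k + 1 ≤ z ∧ A.length + k + r + 2 ≤ t ∧
        t + r ≤ n - z + (A.length + k) := by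
      by_cases hc : t + r ≤ n - z + (A.length + 1)
      · exact ⟨1, le_rfl, hz, by omega, hc⟩
      · exact ⟨t + r - (n - z) - A.length, by omega, by omega, by omega, by omega⟩
    obtain ⟨K', V', A', B', β', h', hA', hAB'⟩ := hk k hk1 hkz
    exact ih h' (fun _ => hAB') (by omega) (by omega)

end IsWalkWithEars

end TwinHost

lemma List.nodup_of_length_le_card_toFinset [DecidableEq X] {l : List X}
    (h : l.length ≤ l.toFinset.card) : l.Nodup := by
  rw [← Multiset.coe_nodup, ← Multiset.toFinset_card_eq_card_iff_nodup]
  exact le_antisymm (List.toFinset_card_le l) h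

/-! ### From a connected leave to two cycles -/

namespace TwinHost

variable [DecidableEq X] {H : TwinHost X} {N : Multiset ℕ} {L K : Multiset (Sym2 X)}
  {n : ℕ} {V : Finset X} {b : Bool} {s e r t h : ℕ}

/-- A walk that visits all vertices of side `b` can be based such that no vertex of that side is
visited twice after the start. -/
lemma exists_base_filter_nodup (hL : IsClosedWalk L s V) (hA : H.Alternates L)
    (hs : s ≤ 2 * (H.onSide b V).card + 2) :
    ∃ c S, L = pathEdges (c :: (S ++ [c])) ∧ s = S.length + 1 ∧ V = (c :: S).toFinset ∧
      (S.filter (H.side · = b)).Nodup := by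
  obtain ⟨c, S, hLS, hsS, hVS⟩ := hL
  -- Of the s/2 visits to side `b`, at most one is a repetition. Starting the walk at the vertex
  -- visited twice removes that repetition from `S`.
  by_cases hnd : ((c :: S).filter (H.side · = b)).Nodup
  · exact ⟨c, S, hLS, hsS, hVS, hnd.sublist ((List.sublist_cons_self _ _).filter _)⟩
  · obtain ⟨l₁, x, l₂, l₃, hW, hx, -⟩ := List.exists_repeat (H.side · = b) _ hnd
    have hperm : (c :: S).Perm (x :: (l₂ ++ x :: (l₃ ++ l₁))) := by
      rw [hW, List.perm_iff_count]; intro y; simp [List.count_cons]; omega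
    have hmem : ∀ y, y ∈ V ↔ y ∈ l₂ ++ x :: (l₃ ++ l₁) := by
      intro y; rw [hVS, List.mem_toFinset, hperm.mem_iff]; simp; tauto
    have hLx : L = pathEdges (x :: ((l₂ ++ x :: (l₃ ++ l₁)) ++ [x])) := by
      rw [hLS, ← cycleEdges_cons, hW, cycleEdges_rotate, ← cycleEdges_cons]
      simp
    refine ⟨x, _, hLx, ?_, ?_, ?_⟩
    · have := hperm.length_eq
      simp at this ⊢; omega
    · ext y
      rw [hmem]; simp; tauto
    · apply List.nodup_of_length_le_card_toFinset
      have e1 := (hLx ▸ hA).two_mul_countP_closed b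
      rw [List.countP_cons_of_pos (by simpa using hx), List.countP_eq_length_filter] at e1
      have e2 : ((l₂ ++ x :: (l₃ ++ l₁)).filter (H.side · = b)).toFinset = H.onSide b V := by
        ext y
        rw [mem_onSide, hmem]; simp; tauto
      rw [e2]
      have := hperm.length_eq
      simp only [List.length_cons] at this
      omega

variable [Fintype X]

/-- A loop of the leave at `x` that can be split off. -/
lemma HasConnectedLeave.exists_loop (hs : H.IsSpacious b s) (he : 2 ≤ e)
    (h : H.HasConnectedLeave N s e) : ∃ x l K V n γ,
      H.Leaves N (pathEdges (x :: (l ++ [x])) + K) ∧ (x :: l).Nodup ∧ IsClosedWalk K n V ∧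
      x ∈ V ∧ n + l.length + 1 = s ∧ (V ∪ l.toFinset).card + e = s ∧ H.side x = H.side γ ∧
      γ ∉ V ∧ γ ∉ l := by
  obtain ⟨L, V, hL, hLw, hV⟩ := h
  -- On side `!b`, the coincidence of the loop and the rest at `x` suffices for a spare vertex.
  have free : ∀ {K n W x l}, H.Leaves N (pathEdges (x :: (l ++ [x])) + K) → IsClosedWalk K n W →
      x ∈ W → n + l.length + 1 = s → H.side x = !b → ∃ γ, H.side x = H.side γ ∧ γ ∉ W ∧ γ ∉ l := by
    intro K n W x l h1 h2 hx hn hxb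
    have e1 := h1.alternates.left.two_mul_card_onSide_le (isClosedWalk_pathEdges x l) (H.side x)
    have e2 := h1.alternates.right.two_mul_card_onSide_le h2 (H.side x)
    have e3 := card_onSide_union_add_inter (H := H) (H.side x) W (x :: l).toFinset
    have e4 : 1 ≤ (H.onSide (H.side x) (W ∩ (x :: l).toFinset)).card :=
      one_le_card_onSide (x := x) (by simp [hx]) rfl
    obtain ⟨γ, hγ, hγW⟩ := hs.exists_notMem (b' := H.side x) (W := W ∪ (x :: l).toFinset)
      (by omega) (by rw [hxb]; simp)
    simp only [Finset.mem_union, List.mem_toFinset, List.mem_cons, not_or] at hγW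
    exact ⟨γ, hγ.symm, hγW.1, hγW.2.2⟩
  by_cases hfree : ∃ γ, H.side γ = b ∧ γ ∉ V
  · obtain ⟨γ₀, hγ₀, hγ₀V⟩ := hfree
    obtain ⟨c, S, hLS, hsS, hVS⟩ := hLw
    have hnd : ¬ ((c :: S).filter (fun _ => decide True)).Nodup := by
      intro h'
      simp only [decide_true, List.filter_true] at h'
      have h1 := List.toFinset_card_of_nodup h'
      rw [← hVS, List.length_cons] at h1
      omega
    obtain ⟨l₁, x, l, l₃, hW, -, hxl, hl⟩ := List.exists_repeat (fun _ => True) _ hnd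
    simp only [decide_true, List.filter_true] at hl
    obtain ⟨K, W, hK, hw, -, -, hx, hVl, hSl⟩ := isClosedWalk_cut hW
    rw [← hLS] at hK
    rw [← hVS] at hVl
    rw [hK] at hL
    have hn : l₁.length + l₃.length + 1 + l.length + 1 = s := by omega
    obtain ⟨γ, hγ, hγW, hγl⟩ : ∃ γ, H.side x = H.side γ ∧ γ ∉ W ∧ γ ∉ l := by
      by_cases hxb : H.side x = b
      · rw [hVl, Finset.mem_union, not_or, List.mem_toFinset] at hγ₀V
        exact ⟨γ₀, by rw [hxb, hγ₀], hγ₀V⟩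
      · exact free hL hw hx hn (by revert hxb; cases H.side x <;> cases b <;> simp)
    exact ⟨x, l, K, W, _, γ, hL, List.nodup_cons.2 ⟨hxl, hl⟩, hw, hx, hn, hVl ▸ hV, hγ, hγW, hγl⟩
  · push Not at hfree
    obtain ⟨c, S, hLS, hsS, hVS, hSb⟩ := exists_base_filter_nodup (b := b) hLw hL.alternates (by
      refine hs.2.trans ?_
      gcongr
      intro x hx
      rw [mem_onSide] at hx ⊢
      exact ⟨hfree x hx.2, hx.2⟩)
    -- Side `b` is used up, so a loop based on side `!b` is needed. At most one visit to `b` is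
    -- repeated while the excess is at least 2, so some vertex of `!b` is visited twice.
    have hnd : ¬ ((c :: S).filter (H.side · = !b)).Nodup := by
      intro h'
      have e1 := (hLS ▸ hL).alternates.two_mul_countP_closed (!b)
      have e2 := (hLS ▸ hL).alternates.two_mul_countP_closed b
      have e3 := card_onSide_add (H := H) V b
      rw [List.countP_eq_length_filter] at e1 e2
      have e4 : (H.onSide (!b) V).card = ((c :: S).filter (H.side · = !b)).length := by
        rw [← List.toFinset_card_of_nodup h']
        congr 1; ext y; rw [mem_onSide, hVS]; simp
      have e5 : (S.filter (H.side · = b)).length ≤ (H.onSide b V).card := by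
        rw [← List.toFinset_card_of_nodup hSb]
        apply Finset.card_le_card
        intro y hy; rw [mem_onSide, hVS]; simp at hy ⊢; tauto
      have e6 : ((c :: S).filter (H.side · = b)).length ≤ (S.filter (H.side · = b)).length + 1 := by
        rw [List.filter_cons]; split <;> simp
      omega
    obtain ⟨l₁, x, l, l₃, hW, hxb, hxl, hl⟩ := List.exists_repeat (H.side · = !b) _ hnd
    obtain ⟨K, W, hK, hw, -, -, hx, hVl, hSl⟩ := isClosedWalk_cut hW
    rw [← hLS] at hK
    rw [← hVS] at hVl
    rw [hK] at hL
    have hn : l₁.length + l₃.length + 1 + l.length + 1 = s := by omega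
    have hlS : l.Sublist S := by
      have := congrArg List.tail hW
      rw [List.tail_cons] at this
      rw [this]
      cases l₁ <;> simp
      exact List.Sublist.trans (List.sublist_append_left _ _)
        ((List.sublist_cons_self _ _).trans (List.sublist_append_right _ _))
    have hl' : l.Nodup := by
      refine List.nodup_of_filter_nodup (p := (H.side · = b)) (hSb.sublist (hlS.filter _)) ?_
      convert hl using 3 with y
      cases H.side y <;> cases b <;> simp
    obtain ⟨γ, hγ, hγW, hγl⟩ := free hL hw hx hn hxb
    exact ⟨x, l, K, W, _, γ, hL, List.nodup_cons.2 ⟨hxl, hl'⟩, hw, hx, hn, hVl ▸ hV, hγ, hγW, hγl⟩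

/-- A connected leave of small excess can be switched to a pair of cycles. -/
lemma HasConnectedLeave.hasTwoCycleLeave (hs : H.IsSpacious b (t + h)) (ht : 4 ≤ t) (hth : t ≤ h)
    (hte : Even t) (he : 1 ≤ e) (het : e + 1 ≤ t) (hL : H.HasConnectedLeave N (t + h) e) :
    H.HasTwoCycleLeave N t h := by
  induction e, he using Nat.le_induction with
  | base =>
    obtain ⟨L, V, hL, ⟨c, S, rfl, hS, rfl⟩, hcard⟩ := hL
    have hnd : ¬ ((c :: S).filter (fun _ => decide True)).Nodup := by
      intro h'
      simp only [decide_true, List.filter_true] at h'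
      have h1 := List.toFinset_card_of_nodup h'
      rw [List.length_cons] at h1
      omega
    obtain ⟨l₁, x, l, l₃, hW, -, hxl, hl⟩ := List.exists_repeat (fun _ => True) _ hnd
    obtain ⟨K, W, hK, hw, -, -, hx, hVl, hSl⟩ := isClosedWalk_cut hW
    obtain ⟨T, rfl, hT, rfl⟩ := hw.exists_base hx
    rw [hK] at hL
    refine hL.hasTwoCycleLeave_of_chain ht hth hte ?_ (by omega)
    apply List.nodup_of_length_le_card_toFinset
    have : (x :: (l ++ T)).toFinset = (c :: S).toFinset := by
      rw [hVl]; ext y; simp; tauto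
    rw [this]
    simp only [List.length_cons, List.length_append]
    omega
  | succ e he ih =>
    -- If the excess cannot be lowered, rigidity applies: a loop is moved to a vertex α on side `b`,
    -- and cutting it at β gives the first pair of ears.
    by_cases hc : H.HasConnectedLeave N (t + h) e
    · exact ih (by omega) hc
    obtain ⟨x, l, K, V, n, γ, hL, hl, hK, hx, hn, hcard, hγ, hγV, hγl⟩ :=
      hL.exists_loop hs (by omega)
    obtain ⟨hdisj, hmove⟩ := hL.exists_move hl hK hx (e := e + 1) (by omega) (by omega)
      (by rw [hn]; exact hc) hγ hγV hγl
    have hl1 := hL.alternates.left.two_le (isClosedWalk_pathEdges x l)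
    obtain ⟨α, hα, hαb⟩ := hL.alternates.right.exists_mem_side hK b
    obtain ⟨Y, hYl, hYn, hYV, hY⟩ := hmove α hα
    have hcl : (V ∪ l.toFinset).card = V.card + l.length := by
      rw [Finset.card_union_of_disjoint, List.toFinset_card_of_nodup (List.nodup_cons.1 hl).2]
      rw [Finset.disjoint_left]
      exact fun y hy hyl => hdisj y (List.mem_toFinset.1 hyl) hy
    have hcY : (V ∪ Y.toFinset).card = V.card + l.length := by
      rw [Finset.card_union_of_disjoint, List.toFinset_card_of_nodup (List.nodup_cons.1 hYn).2, hYl]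
      rw [Finset.disjoint_left]
      exact fun y hy hyl => hYV y (List.mem_toFinset.1 hyl) hy
    have ears : ∀ k, k < l.length → ∃ A B β, A.length = k ∧
        H.IsWalkWithEars N b (t + h) (e + 1) n e K V α A B β := by
      intro k hk
      obtain ⟨A, β, B, rfl, hA⟩ := List.exists_eq_append_cons_of_lt_length (l := Y) (k := k)
        (by omega)
      have hp : (A ++ β :: B).Perm (β :: (A ++ B)) := List.perm_middle
      have hpn := hp.nodup_iff.1 (List.nodup_cons.1 hYn).2
      have hlY : A.length + B.length + 1 = l.length := by rw [← hYl]; simp; omega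
      refine ⟨A, B.reverse, β, hA, ⟨?_, hK, hα, hαb, by omega, hpn.sublist (by simp), ?_,
        fun z hz => hYV z (by simp [hz]), fun z hz => hYV z (by simp at hz; simp [hz]),
        hYV β (by simp), by simp; omega, ?_⟩⟩
      · rw [List.append_assoc, List.cons_append, pathEdges_cons_append] at hY
        rw [pathEdges_reverse_cons_concat]
        convert hY using 1
        abel
      · have : (β :: B.reverse).Perm (β :: B) := (List.reverse_perm B).cons β
        rw [this.nodup_iff]
        exact hpn.sublist (by simp)
      · rw [show (A ++ β :: B.reverse).toFinset = (A ++ β :: B).toFinset by ext; simp, hcY, ← hcl,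
          hcard]
    have hb : 2 * (e + 1) ≤ n := by
      obtain ⟨A, B, β, -, h'⟩ := ears 0 (by omega)
      exact h'.two_mul_le hs (by omega) hc
    -- As before, the least `k` satisfying the second inequality is taken; `hb` then gives the
    -- first.
    obtain ⟨k, hk, hk1, hk2⟩ : ∃ k, k < l.length ∧ k + e + 2 ≤ t ∧ t + e ≤ n + k := by
      by_cases h' : t + e ≤ n
      · exact ⟨0, by omega, by omega, by omega⟩
      · exact ⟨t + e - n, by omega, by omega, by omega⟩
    obtain ⟨A, B, β, hA, h'⟩ := ears k hk
    exact h'.hasTwoCycleLeave_of_le hs (by omega) hc (by omega) rfl ht hte (by omega) (by omega)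

end TwinHost

/-! ### Joining the three cycles and merging two of them -/

namespace TwinHost

variable [DecidableEq X] {H : TwinHost X} {N : Multiset ℕ} {L K : Multiset (Sym2 X)}
  {b : Bool} {m m' t h : ℕ}

lemma leaves_cons_iff : H.Leaves (h ::ₘ N) L ↔
    ∃ D : List X, D.Nodup ∧ 2 ≤ D.length ∧ D.length = h ∧ H.Leaves N (cycleEdges D + L) := by
  constructor
  · rintro ⟨E, ⟨C, F, hC, hN, hF, rfl⟩, hE⟩
    obtain ⟨D, hDC, rfl, hN'⟩ := (Multiset.map_eq_cons _ _ _ _).2 hN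
    obtain ⟨C, rfl⟩ := Multiset.exists_cons_of_mem hDC
    rw [Multiset.erase_cons_head] at hN'
    refine ⟨D, (hC D (by simp)).1, (hC D (by simp)).2, rfl, _,
      ⟨C, F, fun c hc => hC c (by simp [hc]), hN', hF, rfl⟩, ?_⟩
    rw [← hE]
    simp only [Multiset.map_cons, Multiset.sum_cons]
    abel
  · rintro ⟨D, hD, hD2, rfl, E, ⟨C, F, hC, hN, hF, rfl⟩, hE⟩
    refine ⟨_, ⟨D ::ₘ C, F, ?_, by simp [hN], hF, rfl⟩, ?_⟩
    · intro c hc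
      rcases Multiset.mem_cons.1 hc with rfl | hc
      · exact ⟨hD, hD2⟩
      · exact hC c hc
    · rw [← hE]
      simp only [Multiset.map_cons, Multiset.sum_cons]
      abel

lemma HasTwoCycleLeave.leaves (hL : H.HasTwoCycleLeave N t h) (ht : 2 ≤ t) (hh : 2 ≤ h) :
    H.Leaves (h ::ₘ t ::ₘ N) 0 := by
  obtain ⟨C, D, hC, hD, rfl, rfl, hL⟩ := hL
  rw [leaves_cons_iff]
  refine ⟨D, hD, hh, rfl, ?_⟩
  rw [leaves_cons_iff]
  exact ⟨C, hC, ht, rfl, by simpa using hL⟩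

lemma IsClosedWalk.exists_cycle {n : ℕ} {V : Finset X} (hL : IsClosedWalk L n V) (hV : V.card = n) :
    ∃ C : List X, C.Nodup ∧ C.length = n ∧ L = cycleEdges C := by
  obtain ⟨c, S, rfl, rfl, rfl⟩ := hL
  exact ⟨c :: S, List.nodup_of_length_le_card_toFinset (by rw [hV]; simp), by simp, rfl⟩

/-- Two cycles of a packing can be switched to a single cycle or to two cycles that share
a vertex. -/
lemma Leaves.exists_cycle_or_meet
    (hL : H.Leaves (m ::ₘ m' ::ₘ N) 0) :
    (∃ C : List X, C.Nodup ∧ 2 ≤ C.length ∧ C.length = m + m' ∧ H.Leaves N (cycleEdges C)) ∨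
    ∃ c S T, H.Leaves N (pathEdges (c :: (S ++ [c])) + pathEdges (c :: (T ++ [c]))) ∧
      (c :: S).Nodup ∧ (c :: T).Nodup ∧ S.length + 1 = m ∧ T.length + 1 = m' := by
  obtain ⟨A, hA, hA2, hAm, hLA⟩ := leaves_cons_iff.1 hL
  obtain ⟨B, hB, hB2, hBm, hLB⟩ := leaves_cons_iff.1 hLA
  clear hL hLA
  subst hAm hBm
  rw [add_zero, add_comm] at hLB
  obtain ⟨a, A, rfl⟩ := List.exists_cons_of_length_pos (l := A) (by omega)
  obtain ⟨c, B, rfl⟩ := List.exists_cons_of_length_pos (l := B) (by omega)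
  rw [cycleEdges_cons, cycleEdges_cons] at hLB
  have based : ∀ {a : X} {A : List X} {w : X}, w ∈ (a :: A).toFinset → (a :: A).Nodup →
      ∃ S, pathEdges (a :: (A ++ [a])) = pathEdges (w :: (S ++ [w])) ∧ (w :: S).Nodup ∧
        S.length = A.length ∧ (a :: A).toFinset = (w :: S).toFinset := by
    intro a A w hw hnd
    obtain ⟨S, hS, hSl, hSm⟩ := (isClosedWalk_pathEdges a A).exists_base hw
    refine ⟨S, hS, List.nodup_of_length_le_card_toFinset ?_, by omega, hSm⟩
    rw [← hSm, List.toFinset_card_of_nodup hnd]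
    simp only [List.length_cons]; omega
  by_cases hmeet : ∃ w, w ∈ (a :: A).toFinset ∧ w ∈ (c :: B).toFinset
  · obtain ⟨w, hwA, hwB⟩ := hmeet
    obtain ⟨S, hS, hS', hSl, -⟩ := based hwA hA
    obtain ⟨T, hT, hT', hTl, -⟩ := based hwB hB
    rw [hS, hT] at hLB
    exact Or.inr ⟨w, S, T, hLB, hS', hT', by simp [hSl], by simp [hTl]⟩
  push Not at hmeet
  obtain ⟨z, hz, hzc⟩ := hLB.alternates.left.exists_mem_side (isClosedWalk_pathEdges a A) (H.side c)
  obtain ⟨S, hS, hS', hSl, hSm⟩ := based hz hA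
  rw [hS] at hLB
  have hcd := List.nodup_cons.1 hS'
  obtain h1 | ⟨L, hLB', hw⟩ := hLB.attach
    (List.ne_nil_of_length_pos (by simp only [List.length_cons] at hA2; omega))
    hcd.1 (isClosedWalk_pathEdges c B) (by simp) hzc
    (fun x hx => hmeet x (by rw [hSm]; exact List.mem_toFinset.2 hx))
  · right
    refine ⟨c, S, B, h1, List.nodup_cons.2 ⟨fun hc => ?_, hcd.2⟩, hB, by simp [hSl], by simp⟩
    exact hmeet c (by rw [hSm]; simp [hc]) (by simp)
  -- The joined walk has m + m' edges and as many vertices, so it is a cycle.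
  · left
    have hV : (insert z ((c :: B).toFinset ∪ S.toFinset)) =
        (a :: A).toFinset ∪ (c :: B).toFinset := by
      rw [hSm]; ext y; simp; tauto
    obtain ⟨C, hC, hCl, rfl⟩ := IsClosedWalk.exists_cycle hw (by
      rw [hV, Finset.card_union_of_disjoint (Finset.disjoint_left.2 hmeet),
        List.toFinset_card_of_nodup hA, List.toFinset_card_of_nodup hB]
      simp; omega)
    exact ⟨C, hC, by rw [hCl]; simp; omega, by rw [hCl]; simp; omega, hLB'⟩

variable [Fintype X]

/-- Two cycles sharing a vertex together with a third cycle of at least the total length can be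
switched to a connected leave. -/
lemma Leaves.hasConnectedLeave (hs : H.IsSpacious b (t + h)) (ht : 4 ≤ t) (hth : t ≤ h)
    {c : X} {S T D : List X}
    (hL : H.Leaves N (cycleEdges D + (pathEdges (c :: (S ++ [c])) + pathEdges (c :: (T ++ [c])))))
    (hS : (c :: S).Nodup) (hT : (c :: T).Nodup) (hD : D.Nodup) (hDl : D.length = h)
    (hlen : S.length + T.length + 2 = t) :
    ∃ e, 1 ≤ e ∧ e + 1 ≤ t ∧ H.HasConnectedLeave N (t + h) e := by
  obtain ⟨d, D, rfl⟩ := List.exists_cons_of_length_pos (l := D) (by omega)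
  rw [cycleEdges_cons] at hL
  have hDw := isClosedWalk_pathEdges d D
  have hSw := isClosedWalk_pathEdges c S
  have hTw := isClosedWalk_pathEdges c T
  have hDl' : D.length + 1 = h := by simpa using hDl
  have hS2 := hL.alternates.right.left.two_le hSw
  have hT2 := hL.alternates.right.right.two_le hTw
  have hcS := List.toFinset_card_of_nodup hS
  have hcT := List.toFinset_card_of_nodup hT
  have hcD := List.toFinset_card_of_nodup hD
  rw [List.length_cons] at hcS hcT hcD
  have hi := Finset.card_union_add_card_inter (c :: S).toFinset (c :: T).toFinset
  have hi1 : 1 ≤ ((c :: S).toFinset ∩ (c :: T).toFinset).card :=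
    Finset.card_pos.2 ⟨c, by simp⟩
  have hi2 : ((c :: S).toFinset ∩ (c :: T).toFinset).card ≤ (c :: S).toFinset.card :=
    Finset.card_le_card Finset.inter_subset_left
  have hi3 : ((c :: S).toFinset ∩ (c :: T).toFinset).card ≤ (c :: T).toFinset.card :=
    Finset.card_le_card Finset.inter_subset_right
  have hSTw := hSw.add hTw (x := c) (by simp) (by simp)
  set V := (c :: S).toFinset ∪ (c :: T).toFinset with hV
  by_cases hmeet : ∃ w, w ∈ (d :: D).toFinset ∧ w ∈ V
  · obtain ⟨w, hwD, hwV⟩ := hmeet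
    have hall := hDw.add hSTw hwD hwV
    have hj := Finset.card_union_add_card_inter (d :: D).toFinset V
    have hj1 : 1 ≤ ((d :: D).toFinset ∩ V).card :=
      Finset.card_pos.2 ⟨w, Finset.mem_inter.2 ⟨hwD, hwV⟩⟩
    have hj2 : ((d :: D).toFinset ∩ V).card ≤ V.card :=
      Finset.card_le_card Finset.inter_subset_right
    -- The excess is t + h minus the number of vertices, hence less than t unless the h-cycle passes
    -- through all vertices of the other two.
    by_cases hsub : (d :: D).toFinset ∪ V = (d :: D).toFinset
    swap
    · have hj3 : (d :: D).toFinset.card < ((d :: D).toFinset ∪ V).card :=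
        Finset.card_lt_card (lt_of_le_of_ne Finset.subset_union_left (Ne.symm hsub))
      refine ⟨t + h - ((d :: D).toFinset ∪ V).card, by omega, by omega, _, (d :: D).toFinset ∪ V, hL, ?_, by omega⟩
      convert hall using 1
      omega
    -- The excess is t, one too many. Side `!b` has at least (t + h)/2 vertices and the h-cycle uses
    -- at most h/2 of them, so a cycle can be split off to a spare vertex there. The leave stays
    -- connected, since the other vertices of that cycle lie on the h-cycle.
    · have hVD : V ⊆ (d :: D).toFinset := Finset.union_eq_left.1 hsub
      obtain ⟨x, hx, hxb⟩ := hL.alternates.right.left.exists_mem_side hSw (!b)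
      obtain ⟨S', hS', hSl', hSm'⟩ := hSw.exists_base hx
      have hSn' : (x :: S').Nodup := by
        apply List.nodup_of_length_le_card_toFinset
        rw [← hSm', List.length_cons]; omega
      have hTD : (d :: D).toFinset ∪ (c :: T).toFinset = (d :: D).toFinset :=
        Finset.union_eq_left.2 (Finset.subset_union_right.trans hVD)
      have hSD : (x :: S').toFinset ⊆ (d :: D).toFinset :=
        hSm' ▸ Finset.subset_union_left.trans hVD
      have hSD' : ∀ y ∈ S', y ∈ (d :: D).toFinset := fun y hy => hSD (by simp [hy])
      have hw := hDw.add hTw (x := c) (hVD (by simp [hV])) (by simp)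
      rw [hTD] at hw
      have hDb := hL.alternates.left.two_mul_card_onSide_le hDw (!b)
      obtain ⟨γ, hγ, hγD⟩ := hs.exists_notMem (b' := !b) (W := (d :: D).toFinset)
        (by omega) (by simp)
      have hL' : H.Leaves N (pathEdges (x :: (S' ++ [x])) +
          (pathEdges (d :: (D ++ [d])) + pathEdges (c :: (T ++ [c])))) := by
        rw [← hS']
        convert hL using 1
        abel
      have hS0 : S' ≠ [] := List.ne_nil_of_length_pos (by omega)
      have hγS : γ ∉ S' := fun h' => hγD (hSD' γ h')
      have hVc : (d :: D).toFinset ∪ S'.toFinset = (d :: D).toFinset :=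
        Finset.union_eq_left.2 (fun y hy => hSD' y (List.mem_toFinset.1 hy))
      have hcard : (insert γ (d :: D).toFinset).card + (t - 1) = t + h := by
        rw [Finset.card_insert_of_notMem hγD]; omega
      refine ⟨t - 1, by omega, by omega, ?_⟩
      obtain h1 | ⟨L, h1, h2⟩ := hL'.split hS0 (List.nodup_cons.1 hSn').1 hw
        (by rintro rfl; exact hγD (hSD (by simp))) (by rw [hxb, hγ]) hγS hγD
      · obtain ⟨y, hy⟩ := List.exists_mem_of_ne_nil S' hS0
        refine ⟨_, _, h1, ?_, hcard⟩
        convert (isClosedWalk_pathEdges γ S').add hw (x := y) (by simp [hy]) (hSD' y hy) using 1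
        · omega
        · rw [List.toFinset_cons (a := γ), Finset.insert_union, Finset.union_comm, hVc]
      · rw [hVc] at h2
        refine ⟨_, _, h1, ?_, hcard⟩
        convert h2 using 1
        omega
  · push Not at hmeet
    obtain ⟨z, hz, hzc⟩ := hL.alternates.left.exists_mem_side hDw (H.side c)
    obtain ⟨D', hD', hDl', hDm'⟩ := hDw.exists_base hz
    have hDn' : (z :: D').Nodup := by
      apply List.nodup_of_length_le_card_toFinset
      rw [← hDm', List.length_cons]; omega
    rw [hD'] at hL
    have hdisj : ∀ y ∈ z :: D', y ∉ V := fun y hy => hmeet y (by rw [hDm']; simpa using hy)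
    have hcV : c ∈ V := by simp [hV]
    have hcD : (V ∪ D'.toFinset).card = V.card + D'.length := by
      rw [Finset.card_union_of_disjoint, List.toFinset_card_of_nodup (List.nodup_cons.1 hDn').2]
      rw [Finset.disjoint_left]
      intro y hy hy'
      exact hdisj y (by simp at hy' ⊢; simp [hy']) hy
    have hzn : z ∉ V ∪ D'.toFinset := by
      rw [Finset.mem_union, List.mem_toFinset]
      exact not_or.2 ⟨hdisj z (by simp), (List.nodup_cons.1 hDn').1⟩
    -- Here 2 ≤ |V| ≤ t - 1. Attaching the h-cycle at `c` gives excess t + 1 - |V|; the other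
    -- outcome also retains the vertex `z` and gives t - |V|.
    obtain h1 | ⟨L, h1, h2⟩ := hL.attach (List.ne_nil_of_length_pos (by omega))
      (List.nodup_cons.1 hDn').1 hSTw hcV hzc hdisj
    · refine ⟨t + h - (V ∪ D'.toFinset).card, by omega, by omega, _, V ∪ D'.toFinset, h1, ?_, by omega⟩
      convert (isClosedWalk_pathEdges c D').add hSTw (x := c) (by simp) hcV using 1
      · omega
      · ext y
        have : y = c → y ∈ V := by rintro rfl; exact hcV
        simp only [Finset.mem_union, List.mem_toFinset, List.mem_cons]; tauto
    · refine ⟨t + h - (V ∪ D'.toFinset).card - 1, by omega, by omega, _,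
        insert z (V ∪ D'.toFinset), h1, ?_, ?_⟩
      · convert h2 using 1
        omega
      · rw [Finset.card_insert_of_notMem hzn]; omega

/-- Two cycles of a packing of the whole host can be merged to one. -/
theorem Leaves.merge (hs : H.IsSpacious b (m + m' + h)) (hmh : m + m' ≤ h)
    (hL : H.Leaves (m ::ₘ m' ::ₘ h ::ₘ N) 0) : H.Leaves (h ::ₘ (m + m') ::ₘ N) 0 := by
  obtain ⟨C, hC, hC2, hCm, hL'⟩ | ⟨c, S, T, hL', hS, hT, rfl, rfl⟩ := hL.exists_cycle_or_meet
  · rw [Multiset.cons_swap]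
    exact leaves_cons_iff.2 ⟨C, hC, hC2, hCm, by simpa using hL'⟩
  · obtain ⟨D, hD, hD2, rfl, hLD⟩ := leaves_cons_iff.1 hL'
    have h1 := hLD.alternates.right.left.even (isClosedWalk_pathEdges c S)
    have h2 := hLD.alternates.right.right.even (isClosedWalk_pathEdges c T)
    have h3 := hLD.alternates.right.left.two_le (isClosedWalk_pathEdges c S)
    have h4 := hLD.alternates.right.right.two_le (isClosedWalk_pathEdges c T)
    obtain ⟨e, he, het, hc⟩ := hLD.hasConnectedLeave hs (by omega) hmh hS hT hD rfl (by omega)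
    exact (hc.hasTwoCycleLeave hs (by omega) hmh (h1.add h2) he het).leaves (by omega) hD2

end TwinHost

/-! ### From multisets of vertex pairs back to sets of labelled edges -/

section Lists

lemma pathEdges_ofFn {n : ℕ} (y : Fin (n + 1) → X) : pathEdges (List.ofFn y) =
    (Finset.univ : Finset (Fin n)).val.map fun i => s(y i.castSucc, y i.succ) := by
  induction n with
  | zero => simp
  | succ n ih =>
    have h := ih (fun i => y i.succ)
    rw [List.ofFn_succ] at h
    rw [List.ofFn_succ, List.ofFn_succ, pathEdges_cons_cons, h, Fin.univ_succ]
    simp [Function.comp_def]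

lemma cycleEdges_ofFn {n : ℕ} (x : Fin (n + 1) → X) : cycleEdges (List.ofFn x) =
    (Finset.univ : Finset (Fin (n + 1))).val.map fun i => s(x i, x (i + 1)) := by
  have h := pathEdges_ofFn (Fin.snoc (α := fun _ => X) x (x 0))
  have h2 : List.ofFn (Fin.snoc (α := fun _ => X) x (x 0)) = List.ofFn x ++ [x 0] := by
    rw [List.ofFn_succ']; simp
  rw [h2] at h
  rw [List.ofFn_succ, cycleEdges_cons, ← List.cons_append, ← List.ofFn_succ, h]
  refine Multiset.map_congr rfl fun i _ => ?_
  rw [Fin.snoc_castSucc]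
  congr 1
  induction i using Fin.lastCases with
  | last => rw [Fin.succ_last, Fin.snoc_last, Fin.last_add_one]
  | cast i => rw [Fin.succ_castSucc, Fin.snoc_castSucc, Fin.coeSucc_eq_succ]

end Lists

section Lifting

variable {β γ ι : Type*}

lemma Finset.exists_disjUnion_of_map_eq_add [DecidableEq β] {f : β → γ} {T : Finset β} {a b : Multiset γ}
    (h : T.val.map f = a + b) : ∃ T₁ T₂, Disjoint T₁ T₂ ∧ T₁ ∪ T₂ = T ∧ T₁.val.map f = a ∧
      T₂.val.map f = b := by
  induction a using Multiset.induction generalizing T with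
  | empty => exact ⟨∅, T, by simp, by simp, rfl, by simpa using h⟩
  | cons z a ih =>
    obtain ⟨t, ht, rfl⟩ := Multiset.mem_map.1 (h ▸ by simp : z ∈ T.val.map f)
    have hT : (T.erase t).val.map f = a + b := by
      apply (Multiset.cons_inj_right (f t)).1
      rw [← Multiset.cons_add, ← h, ← Multiset.map_cons, Finset.erase_val,
        Multiset.cons_erase ht]
    obtain ⟨T₁, T₂, h1, h2, h3, h4⟩ := ih hT
    have ht' : t ∉ T₁ ∪ T₂ := by rw [h2]; simp
    rw [Finset.mem_union, not_or] at ht'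
    refine ⟨insert t T₁, T₂, ?_, ?_, ?_, h4⟩
    · rw [Finset.disjoint_insert_left]; exact ⟨ht'.2, h1⟩
    · rw [Finset.insert_union, h2, Finset.insert_erase ht]
    · rw [Finset.insert_val_of_notMem ht'.1, Multiset.map_cons, h3]

/-- Equality of the multisets says that corresponding fibres have the same size; bijections between
the fibres are glued together. -/
lemma Finset.exists_injective_of_map_eq [Fintype ι] {f : β → γ} {T : Finset β} {g : ι → γ}
    (h : T.val.map f = (Finset.univ : Finset ι).val.map g) :
    ∃ e : ι → β, Function.Injective e ∧ (∀ i, f (e i) = g i) ∧ Set.range e = T := by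
  have h' : (Finset.univ : Finset T).val.map (fun t : T => f t) = Finset.univ.val.map g := by
    rw [← h, ← Multiset.attach_map_val' T.val f]; rfl
  have key : ∀ z, Nonempty ({i // g i = z} ≃ {t : T // f t = z}) := by
    intro z
    classical
    rw [← Fintype.card_eq]
    have h1 := congrArg (Multiset.count z) h'
    rw [Multiset.count_map, Multiset.count_map] at h1
    rw [Fintype.card_subtype, Fintype.card_subtype]
    simp only [eq_comm (a := z)] at h1
    exact h1.symm
  let E := Equiv.ofFiberEquiv fun z => (key z).some
  refine ⟨fun i => (E i : β), fun i j hij => E.injective (Subtype.ext hij), fun i => ?_, ?_⟩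
  · exact Equiv.ofFiberEquiv_map (fun z => (key z).some) i
  · ext t
    constructor
    · rintro ⟨i, rfl⟩
      exact (E i).2
    · exact fun ht => ⟨E.symm ⟨t, ht⟩, by simp⟩

end Lifting

namespace Graph

section CyclePartition

variable {α β : Type*} {G : Graph α β} {S : Set β}

lemma hasCyclePartition_nil : G.HasCyclePartition S [] ↔ S = ∅ := by
  constructor
  · rintro ⟨C, -, -, rfl⟩
    have : IsEmpty (Fin ([] : List ℕ).length) := Fin.isEmpty
    exact Set.iUnion_of_empty C
  · rintro rfl
    exact ⟨fun _ => ∅, fun i => i.elim0, fun i => i.elim0, by simp⟩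

lemma hasCyclePartition_cons {m : ℕ} {M : List ℕ} : G.HasCyclePartition S (m :: M) ↔
    ∃ C T, G.IsCycleOfLength m C ∧ Disjoint C T ∧ C ∪ T = S ∧ G.HasCyclePartition T M := by
  constructor
  · rintro ⟨C, hC, hd, rfl⟩
    refine ⟨C (0 : Fin (M.length + 1)), ⋃ i : Fin M.length, C i.succ, hC (0 : Fin (M.length + 1)),
      ?_, ?_, fun i => C i.succ, fun i => hC i.succ, ?_, rfl⟩
    · rw [Set.disjoint_iUnion_right]
      exact fun i => hd (Fin.succ_ne_zero i).symm
    · ext y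
      simp only [Set.mem_union, Set.mem_iUnion]
      exact (Fin.exists_fin_succ (n := M.length) (P := fun i => y ∈ C i)).symm
    · exact fun i j hij => hd (fun h => hij (Fin.succ_injective _ h))
  · rintro ⟨C, T, hC, hd, rfl, D, hD, hdD, rfl⟩
    refine ⟨Fin.cons (n := M.length) C D, ?_, ?_, ?_⟩
    · exact Fin.cases hC hD
    · rw [Set.disjoint_iUnion_right] at hd
      intro i j
      revert i j
      refine Fin.cases (Fin.cases ?_ ?_) (fun i => Fin.cases ?_ ?_)
      · exact fun h => absurd rfl h
      · exact fun j _ => hd j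
      · exact fun _ => (hd i).symm
      · exact fun j hij => hdD (fun h => hij (congrArg Fin.succ h))
    · ext y
      simp only [Set.mem_union, Set.mem_iUnion]
      exact Fin.exists_fin_succ

/-- A set of edges induces a cycle if and only if the ends of its edges are the pairs of
consecutive vertices of a cyclic list of distinct vertices. -/
lemma isCycleOfLength_iff [DecidableEq β] [DecidableEq α] {f : β → Sym2 α}
    (hf : ∀ e x y, G.IsLink e x y ↔ f e = s(x, y)) {m : ℕ} {T : Finset β} :
    G.IsCycleOfLength m T ↔
      ∃ c : List α, c.Nodup ∧ 2 ≤ c.length ∧ c.length = m ∧ T.val.map f = cycleEdges c := by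
  constructor
  · rintro ⟨hm, x, e, hx, he, hl, hT⟩
    obtain ⟨k, rfl⟩ := Nat.exists_eq_add_of_le' (show 1 ≤ m by omega)
    change Fin (k + 1) → α at x
    change Fin (k + 1) → β at e
    refine ⟨List.ofFn x, List.nodup_ofFn.2 hx, by simpa using hm, by simp, ?_⟩
    have : T = Finset.univ.map ⟨e, he⟩ := by
      apply Finset.coe_injective; rw [← hT, Finset.coe_map, Finset.coe_univ, Set.image_univ]; rfl
    rw [this, cycleEdges_ofFn, Finset.map_val, Multiset.map_map]
    exact Multiset.map_congr rfl fun i _ => (hf _ _ _).1 (hl i)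
  · rintro ⟨c, hc, hc2, rfl, hT⟩
    obtain ⟨k, hk⟩ := Nat.exists_eq_add_of_le' (show 1 ≤ c.length by omega)
    obtain ⟨x, rfl⟩ : ∃ x : Fin (k + 1) → α, c = List.ofFn x := by
      rw [← List.ofFn_get c]
      generalize c.get = y at *
      revert y
      rw [hk]
      exact fun y => ⟨y, rfl⟩
    rw [cycleEdges_ofFn] at hT
    obtain ⟨e, he, hfe, hr⟩ := Finset.exists_injective_of_map_eq hT
    rw [hk]
    exact ⟨by omega, x, e, List.nodup_ofFn.1 hc, he, fun i => (hf _ _ _).2 (hfe i), hr⟩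

/-- Only multiplicities of vertex pairs matter: if the pairs are distributed among cycles, the edges
of `T` over each pair can be distributed accordingly in any manner. -/
lemma hasCyclePartition_iff [DecidableEq β] [DecidableEq α] {f : β → Sym2 α}
    (hf : ∀ e x y, G.IsLink e x y ↔ f e = s(x, y)) {M : List ℕ} {T : Finset β} :
    G.HasCyclePartition T M ↔ ∃ C : Multiset (List α), (∀ c ∈ C, c.Nodup ∧ 2 ≤ c.length) ∧
      C.map List.length = M ∧ T.val.map f = (C.map cycleEdges).sum := by
  induction M generalizing T with
  | nil =>
    rw [hasCyclePartition_nil]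
    constructor
    · intro h
      rw [Finset.coe_eq_empty.1 h]
      exact ⟨0, by simp, by simp, by simp⟩
    · rintro ⟨C, -, hC, hT⟩
      rw [Multiset.coe_nil, Multiset.map_eq_zero] at hC
      subst hC
      simpa using hT
  | cons m M ih =>
    rw [hasCyclePartition_cons]
    constructor
    · rintro ⟨D, R, hD, hd, hDR, hR⟩
      lift D to Finset β using T.finite_toSet.subset (hDR ▸ Set.subset_union_left)
      lift R to Finset β using T.finite_toSet.subset (hDR ▸ Set.subset_union_right)
      obtain ⟨c, hc, hc2, rfl, hcD⟩ := (isCycleOfLength_iff hf).1 hD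
      obtain ⟨C, hC, hCM, hCR⟩ := ih.1 hR
      rw [← Finset.coe_union, Finset.coe_inj] at hDR
      rw [Finset.disjoint_coe] at hd
      refine ⟨c ::ₘ C, ?_, by simp [hCM], ?_⟩
      · intro d hd
        rcases Multiset.mem_cons.1 hd with rfl | hd
        · exact ⟨hc, hc2⟩
        · exact hC d hd
      · rw [← hDR, ← Finset.disjUnion_eq_union _ _ hd, Finset.disjUnion_val, Multiset.map_add, hcD,
          hCR, Multiset.map_cons, Multiset.sum_cons]
    · rintro ⟨C, hC, hCM, hT⟩
      rw [← Multiset.cons_coe] at hCM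
      obtain ⟨c, hcC, rfl, hCM'⟩ := (Multiset.map_eq_cons _ _ _ _).2 hCM
      obtain ⟨C, rfl⟩ := Multiset.exists_cons_of_mem hcC
      rw [Multiset.erase_cons_head] at hCM'
      rw [Multiset.map_cons, Multiset.sum_cons] at hT
      obtain ⟨D, R, hd, rfl, hD, hR⟩ := Finset.exists_disjUnion_of_map_eq_add hT
      exact ⟨D, R, (isCycleOfLength_iff hf).2 ⟨c, (hC c (by simp)).1, (hC c (by simp)).2, rfl, hD⟩,
        Finset.disjoint_coe.2 hd, (Finset.coe_union _ _).symm,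
        ih.2 ⟨C, fun d hd => hC d (by simp [hd]), hCM', hR⟩⟩

end CyclePartition

end Graph

/-! ### The complete bipartite multigraph as a host -/

namespace Graph

variable {l v u : ℕ}

/-- The ends of an edge of the complete bipartite multigraph. -/
def bipartiteEnds (e : Fin v × Fin u × Fin l) : Sym2 (Fin v ⊕ Fin u) :=
  s(Sum.inl e.1, Sum.inr e.2.1)

lemma completeBipartiteMultigraph_isLink_iff (e : Fin v × Fin u × Fin l) (x y : Fin v ⊕ Fin u) :
    (completeBipartiteMultigraph l v u).IsLink e x y ↔ bipartiteEnds e = s(x, y) := by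
  rw [bipartiteEnds, Sym2.eq_iff]
  constructor
  · rintro (⟨rfl, rfl⟩ | ⟨rfl, rfl⟩) <;> simp
  · rintro (⟨rfl, rfl⟩ | ⟨rfl, rfl⟩)
    · exact Or.inl ⟨rfl, rfl⟩
    · exact Or.inr ⟨rfl, rfl⟩

lemma completeBipartiteMultigraph_inc_iff (e : Fin v × Fin u × Fin l) (x : Fin v ⊕ Fin u) :
    (completeBipartiteMultigraph l v u).Inc e x ↔ x ∈ bipartiteEnds e := by
  rw [Sym2.mem_iff_exists]
  exact exists_congr fun y => completeBipartiteMultigraph_isLink_iff e x y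

lemma count_map_bipartiteEnds (i : Fin v) (j : Fin u) :
    ((Finset.univ : Finset (Fin v × Fin u × Fin l)).val.map bipartiteEnds).count
      s(Sum.inl i, Sum.inr j) = l := by
  rw [Multiset.count_map, ← Finset.filter_val, Finset.card_val]
  have : (Finset.univ.filter fun e : Fin v × Fin u × Fin l =>
      s(Sum.inl i, Sum.inr j) = bipartiteEnds e) = {i} ×ˢ {j} ×ˢ Finset.univ := by
    ext ⟨a, b, k⟩
    simp [bipartiteEnds, eq_comm, and_comm]
  rw [this]
  simp

lemma isLeft_ne_of_mem_map_bipartiteEnds {x y : Fin v ⊕ Fin u}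
    (h : s(x, y) ∈ (Finset.univ : Finset (Fin v × Fin u × Fin l)).val.map bipartiteEnds) :
    x.isLeft ≠ y.isLeft := by
  obtain ⟨e, -, he⟩ := Multiset.mem_map.1 h
  rcases Sym2.eq_iff.1 he with ⟨rfl, rfl⟩ | ⟨rfl, rfl⟩ <;> simp

/-- The complete bipartite multigraph as a host of packings. -/
def bipartiteHost (l v u : ℕ) (p : Prop) : TwinHost (Fin v ⊕ Fin u) where
  side := Sum.isLeft
  edges := (Finset.univ : Finset (Fin v × Fin u × Fin l)).val.map bipartiteEnds
  side_ne _ _ := isLeft_ne_of_mem_map_bipartiteEnds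
  count_eq a b x hab := by
    have h0 : ∀ a : Fin v ⊕ Fin u, a.isLeft = x.isLeft →
        ((Finset.univ : Finset (Fin v × Fin u × Fin l)).val.map bipartiteEnds).count s(a, x) = 0 :=
      fun a ha => Multiset.count_eq_zero.2 fun h => isLeft_ne_of_mem_map_bipartiteEnds h ha
    by_cases hax : a.isLeft = x.isLeft
    · rw [h0 a hax, h0 b (hab ▸ hax)]
    · rcases a with a | a <;> rcases b with b | b <;> rcases x with x | x <;> simp at hab hax
      · rw [count_map_bipartiteEnds, count_map_bipartiteEnds]
      · rw [Sym2.eq_swap, count_map_bipartiteEnds, Sym2.eq_swap, count_map_bipartiteEnds]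
  hasFactor := p

lemma card_onSide_bipartiteHost (p : Prop) :
    ((bipartiteHost l v u p).onSide true Finset.univ).card = v ∧
      ((bipartiteHost l v u p).onSide false Finset.univ).card = u := by
  constructor
  · have : (bipartiteHost l v u p).onSide true Finset.univ =
        Finset.univ.map Function.Embedding.inl := by
      ext (x | x) <;> simp [TwinHost.mem_onSide, bipartiteHost]
    rw [this]; simp
  · have : (bipartiteHost l v u p).onSide false Finset.univ =
        Finset.univ.map Function.Embedding.inr := by
      ext (x | x) <;> simp [TwinHost.mem_onSide, bipartiteHost]
    rw [this]; simp

lemma hasCycleDecomposition_iff_leaves {p : Prop} (hp : ¬ p) (M : List ℕ) :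
    (completeBipartiteMultigraph l v u).HasCycleDecomposition M ↔
      (bipartiteHost l v u p).Leaves M 0 := by
  have h := hasCyclePartition_iff (G := completeBipartiteMultigraph l v u) (M := M)
    completeBipartiteMultigraph_isLink_iff (T := Finset.univ)
  rw [Finset.coe_univ] at h
  refine Iff.trans h ⟨?_, ?_⟩
  · rintro ⟨C, hC, hM, hT⟩
    exact ⟨_, ⟨C, 0, hC, hM, Or.inl ⟨hp, rfl⟩, rfl⟩, by rw [add_zero, add_zero, ← hT]; rfl⟩
  · rintro ⟨E, ⟨C, F, hC, hM, hF, rfl⟩, hE⟩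
    obtain ⟨-, rfl⟩ := hF.resolve_right fun h => hp h.1
    exact ⟨C, hC, hM, by rw [add_zero, add_zero] at hE; exact hE.symm⟩

lemma isOneFactor_iff {T : Finset (Fin v × Fin u × Fin l)} :
    (completeBipartiteMultigraph l v u).IsOneFactor T ↔
      ∀ x, ((T.val.map bipartiteEnds).filter (x ∈ ·)).card = 1 := by
  have h : ∀ x, ((T.val.map bipartiteEnds).filter (x ∈ ·)).card = 1 ↔
      ∃! e, e ∈ (T : Set (Fin v × Fin u × Fin l)) ∧
        (completeBipartiteMultigraph l v u).Inc e x := by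
    intro x
    rw [Multiset.filter_map, Multiset.card_map, ← Finset.filter_val, Finset.card_val,
      Finset.card_eq_one_iff_existsUnique]
    simp [completeBipartiteMultigraph_inc_iff]
  constructor
  · exact fun hT x => (h x).2 (hT.2 x (Set.mem_univ x))
  · exact fun hT => ⟨Set.subset_univ _, fun x _ => (h x).1 (hT x)⟩

lemma exists_isOneFactor_iff_leaves {p : Prop} (hp : p) (M : List ℕ) :
    (∃ F, (completeBipartiteMultigraph l v u).IsOneFactor F ∧
      (completeBipartiteMultigraph l v u).HasCyclePartition
        ((completeBipartiteMultigraph l v u).edgeSet \ F) M) ↔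
      (bipartiteHost l v u p).Leaves M 0 := by
  have h := fun T => hasCyclePartition_iff (G := completeBipartiteMultigraph l v u) (M := M)
    completeBipartiteMultigraph_isLink_iff (T := T)
  constructor
  · rintro ⟨F, hF, hM⟩
    lift F to Finset (Fin v × Fin u × Fin l) using Set.toFinite F
    have hc : (completeBipartiteMultigraph l v u).edgeSet \ (F : Set _) =
        ((Fᶜ : Finset (Fin v × Fin u × Fin l)) : Set _) := by
      rw [Finset.coe_compl, Set.compl_eq_univ_sdiff]; rfl
    rw [hc] at hM
    obtain ⟨C, hC, hCM, hT⟩ := (h _).1 hM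
    refine ⟨_, ⟨C, F.val.map bipartiteEnds, hC, hCM, Or.inr ⟨hp, isOneFactor_iff.1 hF⟩, rfl⟩, ?_⟩
    have hu : (Finset.univ : Finset (Fin v × Fin u × Fin l)) =
        Fᶜ.disjUnion F disjoint_compl_left := by
      rw [Finset.disjUnion_eq_union]; ext; simp; tauto
    change _ = Finset.univ.val.map bipartiteEnds
    rw [hu, Finset.disjUnion_val, Multiset.map_add, hT, add_zero]
  · rintro ⟨E, ⟨C, F, hC, hM, hF, rfl⟩, hE⟩
    have hF' := (hF.resolve_left fun h => h.1 hp).2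
    rw [add_zero] at hE
    obtain ⟨T, F, hd, hTF, hT, rfl⟩ := Finset.exists_disjUnion_of_map_eq_add hE.symm
    refine ⟨F, isOneFactor_iff.2 hF', ?_⟩
    have hc : (completeBipartiteMultigraph l v u).edgeSet \ (F : Set _) = (T : Set _) := by
      change Set.univ \ _ = _
      rw [← Finset.coe_univ, ← Finset.coe_sdiff, ← hTF, Finset.union_sdiff_right,
        Finset.sdiff_eq_self_of_disjoint hd]
    rw [hc]
    exact (h T).2 ⟨C, hC, hM, hT⟩

end Graph

theorem mainTheorem3 (l v u : ℕ) (hvu : v ≤ u) (M : List ℕ) (h m m' : ℕ)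
    (hdec : (Graph.completeBipartiteMultigraph l v u).HasStarCycleDecomposition
      (M ++ [h, m, m']))
    (hmh : m + m' ≤ h)
    (hlt : v < u → m + m' + h ≤ 2 * v + 2)
    (heq : v = u → m + m' + h ≤ 2 * v) :
    (Graph.completeBipartiteMultigraph l v u).HasStarCycleDecomposition
      (M ++ [h, m + m']) := by
  have merge : ∀ p, (Graph.bipartiteHost l v u p).Leaves ↑(M ++ [h, m, m']) 0 →
      (Graph.bipartiteHost l v u p).Leaves ↑(M ++ [h, m + m']) 0 := by
    intro p hL
    -- The distinguished side `true` is the part with v vertices. If v < u, then 2v + 2 ≤ 2u gives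
    -- the bound for the other part.
    have hs : (Graph.bipartiteHost l v u p).IsSpacious true (m + m' + h) := by
      obtain ⟨h1, h2⟩ := Graph.card_onSide_bipartiteHost (l := l) (v := v) (u := u) p
      rw [TwinHost.IsSpacious, h1, Bool.not_true, h2]
      omega
    have e1 : ((M ++ [h, m, m'] : List ℕ) : Multiset ℕ) = m ::ₘ m' ::ₘ h ::ₘ ↑M := by
      simp only [Multiset.cons_coe, Multiset.coe_eq_coe]
      rw [List.perm_iff_count]; intro a; simp [List.count_cons]; omega
    have e2 : ((M ++ [h, m + m'] : List ℕ) : Multiset ℕ) = h ::ₘ (m + m') ::ₘ ↑M := by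
      simp only [Multiset.cons_coe, Multiset.coe_eq_coe]
      rw [List.perm_iff_count]; intro a; simp [List.count_cons]; omega
    rw [e1] at hL
    rw [e2]
    exact hL.merge hs hmh
  -- The parity of the degrees does not involve the list of lengths, so both decompositions fall
  -- under the same case: the host with `hasFactor` false for an even graph, and true for an odd
  -- one.
  rcases hdec with ⟨heven, hdec⟩ | ⟨hodd, hdec⟩
  · refine Or.inl ⟨heven, ?_⟩
    rw [Graph.hasCycleDecomposition_iff_leaves not_false] at hdec ⊢
    exact merge _ hdec
  · refine Or.inr ⟨hodd, ?_⟩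
    rw [Graph.exists_isOneFactor_iff_leaves trivial] at hdec ⊢
    exact merge _ hdec
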